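/- Let $1\le d\le m$ and let $\mathbf a=(a_i)_{i=1}^m$ be a non-increasing sequence of strictly positive real numbers. Let $f:[0,\infty)\to[0,\infty)$ be non-decreasing and convex. For a sequence $\mathcal F=\{\phi_i\}_{i=1}^m$ in $\mathbb C^d$ let $T^{\mathcal F}:\mathbb C^m\to\mathbb C^d$, $T^{\mathcal F}x=\sum_i x_i\phi_i$, and let $S^{\mathcal F}=T^{\mathcal F}(T^{\mathcal F})^*$ be its frame operator. Put $$\mathcal B(\mathbf a)=\{\mathcal F=\{\phi_i\}_{i=1}^m\subset\mathbb C^d:\ \|\phi_i\|^2=a_i\text{ for every }i\},\qquad \mathcal R(\mathbf a)=\{S^{\mathcal F}:\ \mathcal F\in\mathcal B(\mathbf a)\},$$ and $P_f(S)=\operatorname{tr} f(S)$ for $S \in \mathcal R(\mathbf a)$. The $d$-irregularity of $\mathbf a$ is $$r=\max\Big\{1\le j\le d-1:\ (d-j)a_j>\sum_{i=j+1}^m a_i\Big\},$$ with $r=0$ if this set is empty. Say that $\mathcal F=\{\phi_i\}_{i=1}^m$ has the form $(\ast)$ if there is an orthonormal basis $\{e_i\}_{i=1}^d$ of $\mathbb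 C^d$ such that $\phi_i=\sqrt{a_i}\,e_i$ for $1\le i\le r$, and $\{\phi_i\}_{i=r+1}^m$ is a tight frame for $V=\operatorname{span}\{e_i\}_{i=r+1}^d$ with frame constant $c=(d-r)^{-1}\sum_{i=r+1}^m a_i$, that is, $c>0$, $\phi_i\in V$ for $i>r$, and $\sum_{i=r+1}^m|\langle x,\phi_i\rangle|^2=c\|x\|^2$ for all $x\in V$. (a) If $\mathcal F\in\mathcal B(\mathbf a)$ has the form $(\ast)$, then $S^{\mathcal F}$ is a global minimizer of $P_f$ on $\mathcal R(\mathbf a)$. (b) If $f$ is moreover strictly convex, and $\mathcal F\in\mathcal B(\mathbf a)$ is such that $S^{\mathcal F}$ is a local minimizer of $P_f$ on $\mathcal R(\mathbf a)$ with respect to the operator norm, then $\mathcal F$ has the form $(\ast)$. -/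

import Mathlib

/-- The synthesis operator `T : ℂ^m → ℂ^d`, `T x = ∑ i, x i • φ i`, of a finite sequence of
vectors, so that the `i`-th canonical basis vector is sent to `φ i`. -/
noncomputable def synthesisOp {m d : ℕ} (φ : Fin m → EuclideanSpace ℂ (Fin d)) :
    EuclideanSpace ℂ (Fin m) →L[ℂ] EuclideanSpace ℂ (Fin d) :=
  ∑ i, (EuclideanSpace.proj i : EuclideanSpace ℂ (Fin m) →L[ℂ] ℂ).smulRight (φ i)

/-- The frame operator `S = T T*`. -/
noncomputable def frameOp {m d : ℕ} (φ : Fin m → EuclideanSpace ℂ (Fin d)) :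
    EuclideanSpace ℂ (Fin d) →L[ℂ] EuclideanSpace ℂ (Fin d) :=
  (synthesisOp φ).comp (ContinuousLinearMap.adjoint (synthesisOp φ))

/-- The functional `P_f(S) = tr f(S)`, with `f(S)` given by the functional calculus of
the self-adjoint operator `S` (every `f` is continuous on its finite spectrum). -/
noncomputable def framePotential {d : ℕ} (f : ℝ → ℝ)
    (S : EuclideanSpace ℂ (Fin d) →L[ℂ] EuclideanSpace ℂ (Fin d)) : ℝ :=
  (LinearMap.trace ℂ (EuclideanSpace ℂ (Fin d)) (cfc f S).toLinearMap).re

/-- `B(a)`: sequences of `m` vectors of `ℂ^d` with prescribed squared norms `a`. -/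
def normSeqs (d : ℕ) {m : ℕ} (a : Fin m → ℝ) : Set (Fin m → EuclideanSpace ℂ (Fin d)) :=
  {φ | ∀ i, ‖φ i‖ ^ 2 = a i}

/-- `R(a)`: the frame operators of the sequences in `B(a)`. -/
def frameOps (d : ℕ) {m : ℕ} (a : Fin m → ℝ) :
    Set (EuclideanSpace ℂ (Fin d) →L[ℂ] EuclideanSpace ℂ (Fin d)) :=
  frameOp '' normSeqs d a

/-- The `d`-irregularity of `a_1, …, a_m`: the largest `1 ≤ j ≤ d - 1` such that
`(d - j) a_j > ∑_{k > j} a_k`, and `0` if there is none. The term `a_j` is `a i` with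
`i = j - 1`, as `Fin m` counts from `0`. -/
noncomputable def irregularity (d : ℕ) {m : ℕ} (a : Fin m → ℝ) : ℕ :=
  open Classical in
  (Finset.univ.filter fun i : Fin m =>
    (i : ℕ) + 1 ≤ d - 1 ∧
      ((d : ℝ) - ((i : ℕ) + 1)) * a i > ∑ k ∈ Finset.univ.filter (fun k => i < k), a k).sup
    fun i => (i : ℕ) + 1

/-- The finite family `ψ` is a frame for the subspace `V`, with frame bounds `A`, `B`. -/
def IsFrameFor {d : ℕ} {ι : Type*} [Fintype ι] (V : Submodule ℂ (EuclideanSpace ℂ (Fin d)))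
    (ψ : ι → EuclideanSpace ℂ (Fin d)) (A B : ℝ) : Prop :=
  0 < A ∧ 0 < B ∧ (∀ i, ψ i ∈ V) ∧
    ∀ x ∈ V, A * ‖x‖ ^ 2 ≤ ∑ i, ‖inner ℂ x (ψ i)‖ ^ 2 ∧
      ∑ i, ‖inner ℂ x (ψ i)‖ ^ 2 ≤ B * ‖x‖ ^ 2

/-- The finite family `ψ` is a tight frame for `V` with frame constant `c`. -/
def IsTightFrameFor {d : ℕ} {ι : Type*} [Fintype ι]
    (V : Submodule ℂ (EuclideanSpace ℂ (Fin d))) (ψ : ι → EuclideanSpace ℂ (Fin d)) (c : ℝ) :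
    Prop :=
  IsFrameFor V ψ c c

/-- With `r` the `d`-irregularity of `a`, there is an orthonormal basis `e` of `ℂ^d` such that
the first `r` vectors of `φ` are `√a_i e_i`, and the remaining ones form a tight frame for
`span {e_i}_{i > r}` with frame constant `(d - r)⁻¹ ∑_{i > r} a_i`. (The indices `1, …, r`
are the elements of `Fin m` and `Fin d` with value less than `r`.) -/
def HasMinimizerForm {m d : ℕ} (a : Fin m → ℝ) (φ : Fin m → EuclideanSpace ℂ (Fin d)) : Prop :=
  ∃ e : OrthonormalBasis (Fin d) ℂ (EuclideanSpace ℂ (Fin d)),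
    (∀ (i : Fin m) (j : Fin d), (i : ℕ) = (j : ℕ) → (i : ℕ) < irregularity d a →
      φ i = ((Real.sqrt (a i) : ℝ) : ℂ) • e j) ∧
    IsTightFrameFor (Submodule.span ℂ (e '' {j : Fin d | irregularity d a ≤ (j : ℕ)}))
      (fun i : {i : Fin m // irregularity d a ≤ (i : ℕ)} => φ i)
      (((d : ℝ) - (irregularity d a : ℝ))⁻¹ *
        ∑ i : {i : Fin m // irregularity d a ≤ (i : ℕ)}, a i)

/-! Write `c` for the tail mean and `μ = (a_1, …, a_r, c, …, c)`. A family of the form `(∗)` has a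
frame operator with spectrum `μ`, so (a) amounts to `∑ f(μ_j) ≤ tr f(S)` for all `S` in `R(a)`.
Gram–Schmidt on the first `d` vectors gives an orthonormal basis in which the leading partial sums
of the diagonal `x` of `S` dominate those of `a`. Jensen gives `∑ f(x_j) ≤ tr f(S)`, and
subgradients of `f` at `μ` together with Abel summation give `∑ f(μ_j) ≤ ∑ f(x_j)`
(`sum_truncatedSpectrum_le_framePotential`).

For (b), each vector is moved on its sphere. Since `f` need not be differentiable and eigenvalues
may cross, the stationarity condition is obtained by compactness from eigenbases and subgradients of
the perturbed operators (`exists_isSubgradientAt_sum_nonneg`). At first order it makes every `φ i`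
an eigenvector of `S` (`IsLocalMinOn.exists_eigenvalue`). At second order it makes the vectors with
eigenvalue above the smallest one, `b`, linearly independent (`IsLocalMinOn.coeff_eq_zero`): a
linear relation would allow mass to be moved into a `b`-eigenvector. Expanding `S φ_i = c_i φ_i`
then shows that such vectors are orthogonal to all the others and have `c_i = a_i`. The rest form a
tight frame with constant `b` for the complement, and the trace identifies the number of split-off
vectors with the irregularity (`hasMinimizerForm_of_eigenvectors`). -/

open ContinuousLinearMap InnerProductSpace Filter Topology

/-! ### Subgradients on the half-line. -/

/-- `g` is a subgradient at `x` of the restriction of `f` to `[0, ∞)`. -/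
def IsSubgradientAt (f : ℝ → ℝ) (x g : ℝ) : Prop :=
  ∀ y, 0 ≤ y → f x + g * (y - x) ≤ f y

/-- The witness is the infimum of the forward slopes, which works at the endpoint `0` too because
monotonicity bounds these slopes below. The two bounds on `g` serve the later compactness argument.
-/
theorem ConvexOn.exists_isSubgradientAt {f : ℝ → ℝ} (hmono : MonotoneOn f (Set.Ici 0))
    (hconv : ConvexOn ℝ (Set.Ici 0) f) {x : ℝ} (hx : 0 ≤ x) :
    ∃ g, 0 ≤ g ∧ g ≤ f (x + 1) - f x ∧ IsSubgradientAt f x g := by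
  set T : Set ℝ := (fun z => (f z - f x) / (z - x)) '' Set.Ioi x
  have hlow : ∀ y, 0 ≤ y → y < x → ∀ t ∈ T, (f x - f y) / (x - y) ≤ t := by
    rintro y hy hyx _ ⟨z, hz, rfl⟩
    exact hconv.slope_mono_adjacent hy (hx.trans (le_of_lt hz)) hyx hz
  have hnn : ∀ t ∈ T, 0 ≤ t := by
    rintro _ ⟨z, hz, rfl⟩
    have hz' : x < z := hz
    exact div_nonneg (sub_nonneg.2 (hmono hx (hx.trans hz'.le) hz'.le)) (sub_nonneg.2 hz'.le)
  have hne : T.Nonempty := ⟨_, x + 1, by simp, rfl⟩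
  have hbdd : BddBelow T := ⟨0, hnn⟩
  refine ⟨sInf T, le_csInf hne hnn, ?_, ?_⟩
  · refine csInf_le hbdd ⟨x + 1, by simp, by simp⟩
  · intro y hy
    rcases lt_trichotomy y x with h | h | h
    · have h1 := le_csInf hne (hlow y hy h)
      rw [div_le_iff₀ (sub_pos.2 h)] at h1
      linarith
    · simp [h]
    · have h1 : sInf T ≤ (f y - f x) / (y - x) := csInf_le hbdd ⟨y, h, rfl⟩
      rw [le_div_iff₀ (sub_pos.2 h)] at h1
      linarith

theorem IsSubgradientAt.le_of_lt {f : ℝ → ℝ} {x y g h : ℝ} (hx : 0 ≤ x) (hxy : x < y)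
    (hg : IsSubgradientAt f x g) (hh : IsSubgradientAt f y h) : g ≤ h := by
  have h1 := hg y (hx.trans hxy.le)
  have h2 := hh x hx
  nlinarith

theorem IsSubgradientAt.lt_of_lt {f : ℝ → ℝ} (hf : StrictConvexOn ℝ (Set.Ici 0) f)
    {x y g h : ℝ} (hx : 0 ≤ x) (hxy : x < y)
    (hg : IsSubgradientAt f x g) (hh : IsSubgradientAt f y h) : g < h := by
  have hy := hx.trans hxy.le
  have h0 := hf.2 hx hy hxy.ne (by norm_num : (0 : ℝ) < 1 / 2)
    (by norm_num : (0 : ℝ) < 1 / 2) (by norm_num)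
  simp only [smul_eq_mul] at h0
  have h1 := hg (1 / 2 * x + 1 / 2 * y) (by positivity)
  have h2 := hh (1 / 2 * x + 1 / 2 * y) (by positivity)
  nlinarith

/-! ### The frame operator as a sum of rank-one operators. -/

section FrameOp

variable {m d : ℕ}

theorem frameOp_eq_sum_rankOne (φ : Fin m → EuclideanSpace ℂ (Fin d)) :
    frameOp φ = ∑ i, rankOne ℂ (φ i) (φ i) := by
  have hT : ∀ x, synthesisOp φ x = ∑ i, x i • φ i := by
    intro x
    simp [synthesisOp]
  have hadj : ∀ x i, (adjoint (synthesisOp φ) x) i = inner ℂ (φ i) x := by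
    intro x i
    have h1 := adjoint_inner_right (synthesisOp φ) (EuclideanSpace.single i (1 : ℂ)) x
    rw [hT] at h1
    simpa [EuclideanSpace.inner_single_left, Pi.single_apply] using h1
  ext1 x
  simp [frameOp, hT, hadj]

theorem frameOp_apply (φ : Fin m → EuclideanSpace ℂ (Fin d)) (x : EuclideanSpace ℂ (Fin d)) :
    frameOp φ x = ∑ i, inner ℂ (φ i) x • φ i := by
  simp [frameOp_eq_sum_rankOne]

theorem inner_frameOp (φ : Fin m → EuclideanSpace ℂ (Fin d)) (x : EuclideanSpace ℂ (Fin d)) :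
    inner ℂ x (frameOp φ x) = ((∑ i, ‖inner ℂ x (φ i)‖ ^ 2 : ℝ) : ℂ) := by
  rw [frameOp_apply, inner_sum]
  push_cast
  refine Finset.sum_congr rfl fun i _ => ?_
  rw [inner_smul_right, ← inner_conj_symm, mul_comm, Complex.mul_conj']

theorem isPositive_frameOp (φ : Fin m → EuclideanSpace ℂ (Fin d)) : (frameOp φ).IsPositive := by
  have := ContinuousLinearMap.isPositive_self_comp_adjoint (synthesisOp φ)
  simpa [frameOp] using this

theorem isSymmetric_frameOp (φ : Fin m → EuclideanSpace ℂ (Fin d)) :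
    (frameOp φ).toLinearMap.IsSymmetric :=
  (isPositive_frameOp φ).isSymmetric

theorem exists_eigenbasis_frameOp (φ : Fin m → EuclideanSpace ℂ (Fin d)) :
    ∃ (u : OrthonormalBasis (Fin d) ℂ (EuclideanSpace ℂ (Fin d))) (l : Fin d → ℝ),
      (∀ j, frameOp φ (u j) = (l j : ℂ) • u j) ∧ ∀ j, 0 ≤ l j := by
  have hs := isSymmetric_frameOp φ
  have hn : Module.finrank ℂ (EuclideanSpace ℂ (Fin d)) = d := by simp
  have key : ∀ j, frameOp φ (hs.eigenvectorBasis hn j) =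
      (hs.eigenvalues hn j : ℂ) • hs.eigenvectorBasis hn j :=
    fun j => hs.apply_eigenvectorBasis hn j
  refine ⟨hs.eigenvectorBasis hn, hs.eigenvalues hn, key, fun j => ?_⟩
  have h := inner_frameOp φ (hs.eigenvectorBasis hn j)
  rw [key, inner_smul_right, inner_self_eq_norm_sq_to_K] at h
  have h' : hs.eigenvalues hn j = ∑ i, ‖inner ℂ (hs.eigenvectorBasis hn j) (φ i)‖ ^ 2 := by
    apply Complex.ofReal_injective
    simpa using h
  rw [h']
  positivity

end FrameOp

/-! ### The trace functional in an eigenbasis, and Jensen's inequality. -/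

section Potential

variable {d : ℕ}

theorem aeval_apply_of_apply_eq_smul
    {S : EuclideanSpace ℂ (Fin d) →L[ℂ] EuclideanSpace ℂ (Fin d)} {x : EuclideanSpace ℂ (Fin d)}
    {l : ℝ} (hx : S x = (l : ℂ) • x) (p : Polynomial ℝ) :
    Polynomial.aeval S p x = ((p.eval l : ℝ) : ℂ) • x := by
  induction p using Polynomial.induction_on' with
  | add p q hp hq => simp [hp, hq, add_smul]
  | monomial n a =>
    have hpow : ∀ n : ℕ, (S ^ n) x = ((l ^ n : ℝ) : ℂ) • x := by
      intro n
      induction n with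
      | zero => simp
      | succ n ih =>
        rw [pow_succ, mul_apply_eq_comp, hx, map_smul, ih, smul_smul]
        push_cast
        rw [pow_succ, mul_comm]
    rw [Polynomial.aeval_monomial, mul_apply_eq_comp, hpow]
    simp [Algebra.algebraMap_eq_smul_one, mul_smul, smul_comm _ a]

theorem framePotential_eq_sum (f : ℝ → ℝ)
    {S : EuclideanSpace ℂ (Fin d) →L[ℂ] EuclideanSpace ℂ (Fin d)} (hS : IsSelfAdjoint S)
    (u : OrthonormalBasis (Fin d) ℂ (EuclideanSpace ℂ (Fin d))) {l : Fin d → ℝ}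
    (hu : ∀ j, S (u j) = (l j : ℂ) • u j) : framePotential f S = ∑ j, f (l j) := by
  classical
  have hspec : spectrum ℝ S ⊆ Set.range l := by
    intro t ht
    set q : Polynomial ℝ := ∏ j, (Polynomial.X - Polynomial.C (l j))
    have hq0 : Polynomial.aeval S q = 0 := by
      apply ContinuousLinearMap.coe_injective
      refine u.toBasis.ext fun j => ?_
      have : q.eval (l j) = 0 := by
        rw [Polynomial.eval_prod]
        exact Finset.prod_eq_zero (Finset.mem_univ j) (by simp)
      simp [aeval_apply_of_apply_eq_smul (hu j), this]
    have h1 := spectrum.subset_polynomial_aeval S q ⟨t, ht, rfl⟩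
    rw [hq0] at h1
    -- The case `d = 0` is not excluded here; in the zero algebra the spectrum is empty.
    have : Nontrivial (EuclideanSpace ℂ (Fin d) →L[ℂ] EuclideanSpace ℂ (Fin d)) := by
      by_contra h
      rw [not_nontrivial_iff_subsingleton] at h
      rw [spectrum.of_subsingleton] at h1
      exact h1
    rw [spectrum.zero_eq, Set.mem_singleton_iff] at h1
    simp only [q, Polynomial.eval_prod, Finset.prod_eq_zero_iff] at h1
    obtain ⟨j, -, hj⟩ := h1
    exact ⟨j, by simpa [sub_eq_zero, eq_comm] using hj⟩
  -- Only the values of `f` at the eigenvalues matter, so an interpolating polynomial replaces `f`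
  -- in the functional calculus.
  set p : Polynomial ℝ := Lagrange.interpolate (Finset.univ.image l) id f
  have hp : ∀ j, p.eval (l j) = f (l j) := fun j =>
    Lagrange.eval_interpolate_at_node f (v := id) Function.injective_id.injOn
      (Finset.mem_image_of_mem l (Finset.mem_univ j))
  have hcfc : cfc f S = Polynomial.aeval S p := by
    rw [← cfc_polynomial p S hS]
    refine cfc_congr fun t ht => ?_
    obtain ⟨j, rfl⟩ := hspec ht
    exact (hp j).symm
  rw [framePotential, hcfc, LinearMap.trace_eq_sum_inner _ u, Complex.re_sum]
  refine Finset.sum_congr rfl fun j _ => ?_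
  rw [ContinuousLinearMap.coe_coe, aeval_apply_of_apply_eq_smul (hu j), hp, inner_smul_right,
    inner_self_eq_norm_sq_to_K]
  simp

theorem inner_apply_self_eq_sum
    {S : EuclideanSpace ℂ (Fin d) →L[ℂ] EuclideanSpace ℂ (Fin d)}
    (u : OrthonormalBasis (Fin d) ℂ (EuclideanSpace ℂ (Fin d))) {l : Fin d → ℝ}
    (hu : ∀ j, S (u j) = (l j : ℂ) • u j) (x : EuclideanSpace ℂ (Fin d)) :
    (inner ℂ x (S x)).re = ∑ j, l j * ‖inner ℂ (u j) x‖ ^ 2 := by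
  have h1 : S x = ∑ j, inner ℂ (u j) x • (l j : ℂ) • u j := by
    conv_lhs => rw [← u.sum_repr' x]
    simp [map_sum, hu]
  rw [h1, inner_sum, Complex.re_sum]
  refine Finset.sum_congr rfl fun j _ => ?_
  rw [inner_smul_right, inner_smul_right, mul_left_comm, ← inner_conj_symm x (u j),
    Complex.mul_conj', ← Complex.ofReal_pow, ← Complex.ofReal_mul, Complex.ofReal_re]

/-- Each diagonal entry averages the eigenvalues with weights `|⟨u_j, e_i⟩|²`. This matrix is doubly
stochastic: row sums allow Jensen, column sums restore `∑ f(l_j)`. -/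
theorem sum_le_framePotential {f : ℝ → ℝ} (hconv : ConvexOn ℝ (Set.Ici 0) f)
    {S : EuclideanSpace ℂ (Fin d) →L[ℂ] EuclideanSpace ℂ (Fin d)} (hS : IsSelfAdjoint S)
    (u : OrthonormalBasis (Fin d) ℂ (EuclideanSpace ℂ (Fin d))) {l : Fin d → ℝ}
    (hu : ∀ j, S (u j) = (l j : ℂ) • u j) (hl : ∀ j, 0 ≤ l j)
    (e : OrthonormalBasis (Fin d) ℂ (EuclideanSpace ℂ (Fin d))) :
    ∑ i, f (inner ℂ (e i) (S (e i))).re ≤ framePotential f S := by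
  rw [framePotential_eq_sum f hS u hu]
  have hJ : ∀ i, f (inner ℂ (e i) (S (e i))).re ≤ ∑ j, ‖inner ℂ (u j) (e i)‖ ^ 2 * f (l j) := by
    intro i
    have h1 := hconv.map_sum_le (t := Finset.univ) (w := fun j => ‖inner ℂ (u j) (e i)‖ ^ 2)
      (p := l) (fun j _ => by positivity) (by simp [u.sum_sq_norm_inner_right]) (fun j _ => hl j)
    simp only [smul_eq_mul] at h1
    rw [inner_apply_self_eq_sum u hu]
    simpa only [mul_comm] using h1
  refine (Finset.sum_le_sum fun i _ => hJ i).trans ?_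
  rw [Finset.sum_comm]
  simp [← Finset.sum_mul, e.sum_sq_norm_inner_left]

end Potential

/-! ### Splitting sums at an index, and Abel summation. -/

theorem Fin.sum_castLE_add_sum_subtype {n r : ℕ} (hr : r ≤ n) {M : Type*} [AddCommMonoid M]
    (F : Fin n → M) :
    ∑ k : Fin r, F (Fin.castLE hr k) + ∑ i : {i : Fin n // r ≤ (i : ℕ)}, F i = ∑ i, F i := by
  have h1 : ∑ k : Fin r, F (Fin.castLE hr k) = ∑ i : {i : Fin n // ¬ r ≤ (i : ℕ)}, F i := by
    refine Finset.sum_bij' (fun k _ => ⟨Fin.castLE hr k, by simp⟩)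
      (fun i _ => ⟨i.1, not_le.1 i.2⟩) ?_ ?_ ?_ ?_ ?_ <;> simp
  rw [h1, add_comm]
  exact Fintype.sum_subtype_add_sum_subtype _ F

theorem Fin.card_subtype_le_val {n r : ℕ} (hr : r ≤ n) :
    ((Fintype.card {i : Fin n // r ≤ (i : ℕ)} : ℕ) : ℝ) = n - r := by
  have h := Fin.sum_castLE_add_sum_subtype hr (fun _ => (1 : ℝ))
  simp only [Finset.sum_const, Finset.card_univ, Fintype.card_fin, nsmul_eq_mul, mul_one] at h
  linarith

/-- Abel summation by induction on the length: `c` is left general so that the inductive hypothesis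
can be used with the last weight in its place. -/
theorem mul_sum_le_sum_mul_of_antitone {r : ℕ} (w y : Fin r → ℝ) (hw : Antitone w)
    (hy : ∀ (k : ℕ) (hk : k ≤ r), 0 ≤ ∑ i : Fin k, y (Fin.castLE hk i)) {c : ℝ}
    (hc : ∀ i, c ≤ w i) : c * ∑ i, y i ≤ ∑ i, w i * y i := by
  induction r generalizing c with
  | zero => simp
  | succ r ih =>
    have h1 := ih (fun i => w i.castSucc) (fun i => y i.castSucc)
      (fun i j hij => hw (Fin.castSucc_le_castSucc_iff.2 hij))
      (fun k hk => by simpa using hy k (hk.trans r.le_succ))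
      (c := w (Fin.last r)) (fun i => hw (Fin.le_last _))
    have h2 : 0 ≤ ∑ i, y i := by simpa using hy (r + 1) le_rfl
    calc c * ∑ i, y i ≤ w (Fin.last r) * ∑ i, y i := by
          exact mul_le_mul_of_nonneg_right (hc _) h2
      _ ≤ _ := by
          rw [Fin.sum_univ_castSucc, Fin.sum_univ_castSucc, mul_add]
          linarith

/-! ### The irregularity and the truncated spectrum. -/

section Irregularity

variable {m d : ℕ} {a : Fin m → ℝ}

theorem irregularity_le : irregularity d a ≤ d - 1 := by
  classical
  exact Finset.sup_le fun i hi => (Finset.mem_filter.1 hi).2.1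

theorem sum_filter_lt_eq_sum_subtype (i : Fin m) {r : ℕ} (hi : (i : ℕ) + 1 = r) :
    ∑ k ∈ Finset.univ.filter (fun k => i < k), a k = ∑ k : {k : Fin m // r ≤ (k : ℕ)}, a k := by
  subst hi
  refine Finset.sum_subtype _ (fun k => ?_) a
  rw [Finset.mem_filter, Fin.lt_def]
  simp

theorem exists_of_irregularity_pos (h : 0 < irregularity d a) :
    ∃ i : Fin m, (i : ℕ) + 1 = irregularity d a ∧
      ∑ k : {k : Fin m // irregularity d a ≤ (k : ℕ)}, a k <
        ((d : ℝ) - irregularity d a) * a i := by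
  classical
  have hne : (Finset.univ.filter fun i : Fin m => (i : ℕ) + 1 ≤ d - 1 ∧
      ((d : ℝ) - ((i : ℕ) + 1)) * a i >
        ∑ k ∈ Finset.univ.filter (fun k => i < k), a k).Nonempty := by
    by_contra hn
    rw [Finset.not_nonempty_iff_eq_empty] at hn
    have h0 : irregularity d a = 0 := by
      have hs := congrArg (fun s => s.sup fun i : Fin m => (i : ℕ) + 1) hn
      refine Eq.trans ?_ hs
      unfold irregularity
      congr!
    omega
  obtain ⟨i, hi, hsup⟩ := Finset.exists_mem_eq_sup _ hne fun i : Fin m => (i : ℕ) + 1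
  have hr : irregularity d a = (i : ℕ) + 1 := by
    rw [← hsup]
    unfold irregularity
    congr!
  have h2 := (Finset.mem_filter.1 hi).2.2
  rw [sum_filter_lt_eq_sum_subtype i hr.symm] at h2
  refine ⟨i, hr.symm, ?_⟩
  have h3 : (irregularity d a : ℝ) = (i : ℕ) + 1 := by exact_mod_cast hr
  rw [h3]
  exact h2

theorem irregularity_eq {r : ℕ} (hr : r ≤ d - 1)
    (h1 : ∀ i : Fin m, (i : ℕ) + 1 = r →
      ∑ k : {k : Fin m // r ≤ (k : ℕ)}, a k < ((d : ℝ) - r) * a i)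
    (hrm : r ≤ m)
    (h2 : ∀ i : Fin m, r ≤ (i : ℕ) → (i : ℕ) + 1 ≤ d - 1 →
      ((d : ℝ) - ((i : ℕ) + 1)) * a i ≤ ∑ k : {k : Fin m // (i : ℕ) + 1 ≤ (k : ℕ)}, a k) :
    irregularity d a = r := by
  classical
  apply le_antisymm
  · refine Finset.sup_le fun i hi => ?_
    obtain ⟨-, hi1, hi2⟩ := Finset.mem_filter.1 hi
    by_contra hlt
    have := h2 i (by omega) hi1
    rw [← sum_filter_lt_eq_sum_subtype i rfl] at this
    linarith
  · rcases Nat.eq_zero_or_pos r with h0 | h0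
    · omega
    · have hi : (⟨r - 1, by omega⟩ : Fin m).val + 1 = r := by simp; omega
      have h3 := h1 _ hi
      rw [← sum_filter_lt_eq_sum_subtype _ hi] at h3
      have hcast : (r : ℝ) = ((⟨r - 1, by omega⟩ : Fin m).val : ℝ) + 1 := by exact_mod_cast hi.symm
      rw [hcast] at h3
      calc r = (⟨r - 1, by omega⟩ : Fin m).val + 1 := hi.symm
        _ ≤ irregularity d a := by
          refine Finset.le_sup (f := fun i : Fin m => (i : ℕ) + 1) ?_
          refine Finset.mem_filter.2 ⟨Finset.mem_univ _, by rw [hi]; exact hr, h3⟩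

/-- The arithmetic mean of the spectrum that remains when the first `r` values are split off. -/
noncomputable def tailMean (d r : ℕ) (a : Fin m → ℝ) : ℝ :=
  ((d : ℝ) - r)⁻¹ * ∑ i : {i : Fin m // r ≤ (i : ℕ)}, a i

/-- The spectrum `a_1, …, a_r, c, …, c` with `c` the tail mean. -/
noncomputable def truncatedSpectrum (r : ℕ) (hdm : d ≤ m) (a : Fin m → ℝ) (j : Fin d) : ℝ :=
  if r ≤ (j : ℕ) then tailMean d r a else a (Fin.castLE hdm j)

theorem sum_truncatedSpectrum {r : ℕ} (hr : r < d) (hdm : d ≤ m) (a : Fin m → ℝ) :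
    ∑ j, truncatedSpectrum r hdm a j = ∑ i, a i := by
  have hpos : (0 : ℝ) < d - r := sub_pos.2 (by exact_mod_cast hr)
  rw [← Fin.sum_castLE_add_sum_subtype hr.le, ← Fin.sum_castLE_add_sum_subtype (hr.le.trans hdm)]
  congr 1
  · refine Finset.sum_congr rfl fun k _ => ?_
    simp [truncatedSpectrum]
  · rw [Finset.sum_congr rfl fun (i : {i : Fin d // r ≤ (i : ℕ)}) _ =>
      show truncatedSpectrum r hdm a i = tailMean d r a from if_pos i.2]
    rw [Finset.sum_const, nsmul_eq_mul, Finset.card_univ]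
    rw [Fin.card_subtype_le_val hr.le, tailMean, mul_inv_cancel_left₀ hpos.ne']

end Irregularity

/-! ### Majorization by Gram–Schmidt. -/

section Schur

variable {m d : ℕ}

theorem sum_inner_frameOp (φ : Fin m → EuclideanSpace ℂ (Fin d))
    (e : OrthonormalBasis (Fin d) ℂ (EuclideanSpace ℂ (Fin d))) :
    ∑ j, (inner ℂ (e j) (frameOp φ (e j))).re = ∑ i, ‖φ i‖ ^ 2 := by
  simp only [inner_frameOp, Complex.ofReal_re]
  rw [Finset.sum_comm]
  exact Finset.sum_congr rfl fun i _ => e.sum_sq_norm_inner_right _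

/-- After Gram–Schmidt, `φ_1, …, φ_k` lie in the span of `e_1, …, e_k`. Their squared norms are
therefore fully accounted for by the first `k` diagonal entries, to which the other vectors only
add. -/
theorem exists_orthonormalBasis_sum_norm_sq_le (hdm : d ≤ m)
    (φ : Fin m → EuclideanSpace ℂ (Fin d)) :
    ∃ e : OrthonormalBasis (Fin d) ℂ (EuclideanSpace ℂ (Fin d)),
      ∀ (k : ℕ) (hk : k ≤ d), ∑ i : Fin k, ‖φ (Fin.castLE (hk.trans hdm) i)‖ ^ 2 ≤
        ∑ j : Fin k, (inner ℂ (e (Fin.castLE hk j)) (frameOp φ (e (Fin.castLE hk j)))).re := by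
  set ψ : Fin d → EuclideanSpace ℂ (Fin d) := fun i => φ (Fin.castLE hdm i)
  have hfr : Module.finrank ℂ (EuclideanSpace ℂ (Fin d)) = Fintype.card (Fin d) := by simp
  refine ⟨gramSchmidtOrthonormalBasis hfr ψ, fun k hk => ?_⟩
  set e := gramSchmidtOrthonormalBasis hfr ψ
  simp only [inner_frameOp, Complex.ofReal_re]
  have h1 : ∀ i : Fin k, ‖φ (Fin.castLE (hk.trans hdm) i)‖ ^ 2 =
      ∑ j : Fin k, ‖inner ℂ (e (Fin.castLE hk j)) (φ (Fin.castLE (hk.trans hdm) i))‖ ^ 2 := by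
    intro i
    rw [← e.sum_sq_norm_inner_right, ← Fin.sum_castLE_add_sum_subtype hk, add_eq_left]
    refine Finset.sum_eq_zero fun j _ => ?_
    have h2 : inner ℂ (e j) (ψ (Fin.castLE hk i)) = 0 := by
      refine gramSchmidtOrthonormalBasis_inv_triangular hfr ψ ?_
      exact Fin.lt_def.2 (lt_of_lt_of_le i.2 j.2)
    have h3 : ψ (Fin.castLE hk i) = φ (Fin.castLE (hk.trans hdm) i) := rfl
    rw [← h3, h2]
    simp
  rw [Finset.sum_congr rfl fun i _ => h1 i, Finset.sum_comm]
  refine Finset.sum_le_sum fun j _ => ?_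
  rw [← Fin.sum_castLE_add_sum_subtype (hk.trans hdm)]
  exact le_add_of_nonneg_right (Finset.sum_nonneg fun i _ => by positivity)

end Schur

/-! ### Global minimality, part (a). -/

section GlobalMin

variable {m d : ℕ} {a : Fin m → ℝ}

theorem tailMean_nonneg {r : ℕ} (hr : r ≤ d) (ha : ∀ i, 0 ≤ a i) : 0 ≤ tailMean d r a := by
  have : (0 : ℝ) ≤ d - r := sub_nonneg.2 (by exact_mod_cast hr)
  exact mul_nonneg (inv_nonneg.2 this) (Finset.sum_nonneg fun i _ => ha i)

/-- The inequality defining the irregularity, taken at `r` itself, says that the tail mean is below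
`a_r`. -/
theorem tailMean_irregularity_lt (hd : 0 < d) (ha : Antitone a)
    (i : Fin m) (hi : (i : ℕ) < irregularity d a) : tailMean d (irregularity d a) a < a i := by
  obtain ⟨j, hj, hlt⟩ := exists_of_irregularity_pos (d := d) (a := a) (by omega)
  have hle := irregularity_le (d := d) (a := a)
  have hpos : (0 : ℝ) < d - irregularity d a := sub_pos.2 (by exact_mod_cast (by omega))
  refine lt_of_lt_of_le ?_ (ha (show i ≤ j from Fin.le_def.2 (by omega)))
  rwa [tailMean, inv_mul_lt_iff₀ hpos]

theorem OrthonormalBasis.mem_span_tail_iff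
    (e : OrthonormalBasis (Fin d) ℂ (EuclideanSpace ℂ (Fin d))) {r : ℕ}
    {x : EuclideanSpace ℂ (Fin d)} :
    x ∈ Submodule.span ℂ (e '' {j : Fin d | r ≤ (j : ℕ)}) ↔
      ∀ j : Fin d, (j : ℕ) < r → inner ℂ (e j) x = 0 := by
  constructor
  · intro hx j hj
    induction hx using Submodule.span_induction with
    | mem y hy =>
      obtain ⟨k, hk, rfl⟩ := hy
      refine e.inner_eq_zero fun hjk => ?_
      subst hjk
      exact absurd hj (not_lt.2 hk)
    | zero => simp
    | add x y _ _ hx hy => simp [hx, hy]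
    | smul c x _ hx => simp [hx]
  · intro hx
    rw [← e.sum_repr' x]
    refine Submodule.sum_mem _ fun j _ => ?_
    by_cases hj : r ≤ (j : ℕ)
    · exact Submodule.smul_mem _ _ (Submodule.subset_span ⟨j, hj, rfl⟩)
    · simp [hx j (not_le.1 hj)]

theorem HasMinimizerForm.exists_eigenbasis (hdm : d ≤ m) (ha : ∀ i, 0 < a i)
    {φ : Fin m → EuclideanSpace ℂ (Fin d)} (h : HasMinimizerForm a φ) :
    ∃ e : OrthonormalBasis (Fin d) ℂ (EuclideanSpace ℂ (Fin d)), ∀ j,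
      frameOp φ (e j) = (truncatedSpectrum (irregularity d a) hdm a j : ℂ) • e j := by
  obtain ⟨e, he, -, -, hV, hT⟩ := h
  set r := irregularity d a
  have hr : r ≤ d := (irregularity_le (d := d) (a := a)).trans (Nat.sub_le _ _)
  set V := Submodule.span ℂ (e '' {j : Fin d | r ≤ (j : ℕ)})
  have hφ : ∀ k : Fin r, φ (Fin.castLE (hr.trans hdm) k) =
      ((Real.sqrt (a (Fin.castLE (hr.trans hdm) k)) : ℝ) : ℂ) • e (Fin.castLE hr k) :=
    fun k => he _ _ rfl k.2
  have horth : ∀ y ∈ V, ∀ k : Fin r, inner ℂ (e (Fin.castLE hr k)) y = 0 := fun y hy k =>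
    e.mem_span_tail_iff.1 hy _ k.2
  have hquad : ∀ x, ∑ i, ‖inner ℂ x (φ i)‖ ^ 2 =
      ∑ j, truncatedSpectrum r hdm a j * ‖inner ℂ (e j) x‖ ^ 2 := by
    intro x
    rw [← Fin.sum_castLE_add_sum_subtype (hr.trans hdm), ← Fin.sum_castLE_add_sum_subtype hr]
    congr 1
    · refine Finset.sum_congr rfl fun k _ => ?_
      rw [hφ, inner_smul_right, norm_mul, mul_pow, Complex.norm_real, Real.norm_eq_abs, sq_abs,
        Real.sq_sqrt (ha _).le, norm_inner_symm]
      simp [truncatedSpectrum]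
    -- The tight frame identity holds only on `V`. The tail vectors lie in `V`, so they see only the
    -- projection `p` of `x`.
    · set p : EuclideanSpace ℂ (Fin d) :=
        ∑ j : {j : Fin d // r ≤ (j : ℕ)}, inner ℂ (e j) x • e j
      have hp : p ∈ V := Submodule.sum_mem _ fun j _ =>
        Submodule.smul_mem _ _ (Submodule.subset_span ⟨j, j.2, rfl⟩)
      have hx : x = ∑ k : Fin r, inner ℂ (e (Fin.castLE hr k)) x • e (Fin.castLE hr k) + p := by
        conv_lhs => rw [← e.sum_repr' x]
        exact (Fin.sum_castLE_add_sum_subtype hr _).symm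
      have hinner : ∀ y ∈ V, inner ℂ x y = inner ℂ p y := by
        intro y hy
        conv_lhs => rw [hx]
        rw [inner_add_left, sum_inner]
        simp [inner_smul_left, horth y hy]
      rw [Finset.sum_congr rfl fun (i : {i : Fin m // r ≤ (i : ℕ)}) _ => by
        rw [hinner _ (hV i)], (hT p hp).2.antisymm (hT p hp).1]
      have hpn : ‖p‖ ^ 2 = ∑ j : {j : Fin d // r ≤ (j : ℕ)}, ‖inner ℂ (e j) x‖ ^ 2 := by
        rw [← e.sum_sq_norm_inner_right, ← Fin.sum_castLE_add_sum_subtype hr]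
        simp only [horth p hp, norm_zero, ne_eq, OfNat.ofNat_ne_zero, not_false_eq_true, zero_pow,
          Finset.sum_const_zero, zero_add]
        refine Finset.sum_congr rfl fun j _ => ?_
        have h1 := hinner (e j) (Submodule.subset_span ⟨j, j.2, rfl⟩)
        rw [norm_inner_symm, ← h1, norm_inner_symm]
      rw [hpn, Finset.mul_sum]
      refine Finset.sum_congr rfl fun j _ => ?_
      rw [truncatedSpectrum, if_pos j.2, tailMean]
  set D : EuclideanSpace ℂ (Fin d) →L[ℂ] EuclideanSpace ℂ (Fin d) :=
    ∑ j, (truncatedSpectrum r hdm a j : ℂ) • rankOne ℂ (e j) (e j)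
  have hDe : ∀ j, D (e j) = (truncatedSpectrum r hdm a j : ℂ) • e j := by
    intro j
    simp only [D, sum_apply, smul_apply, rankOne_apply]
    rw [Finset.sum_eq_single j]
    · simp
    · intro k _ hk
      simp [e.inner_eq_zero hk]
    · simp
  have hSD : (frameOp φ).toLinearMap = D.toLinearMap := by
    -- Over `ℂ` the quadratic form determines the operator.
    refine (ext_inner_map _ _).1 fun x => ?_
    have h1 : inner ℂ x (frameOp φ x) = inner ℂ x (D x) := by
      rw [inner_frameOp, hquad]
      simp only [D, sum_apply, smul_apply, rankOne_apply, inner_sum, inner_smul_right]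
      push_cast
      refine Finset.sum_congr rfl fun j _ => ?_
      rw [← inner_conj_symm x (e j), Complex.mul_conj']
    have h2 := congrArg (starRingEnd ℂ) h1
    rwa [inner_conj_symm, inner_conj_symm] at h2
  refine ⟨e, fun j => ?_⟩
  rw [← hDe]
  exact DFunLike.congr_fun hSD (e j)

theorem sum_truncatedSpectrum_le_framePotential {f : ℝ → ℝ} (hf_mono : MonotoneOn f (Set.Ici 0))
    (hf_conv : ConvexOn ℝ (Set.Ici 0) f) (hd : 0 < d) (hdm : d ≤ m)
    (ha_pos : ∀ i, 0 < a i) (ha : Antitone a) {φ : Fin m → EuclideanSpace ℂ (Fin d)}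
    (hφ : φ ∈ normSeqs d a) :
    ∑ j, f (truncatedSpectrum (irregularity d a) hdm a j) ≤ framePotential f (frameOp φ) := by
  set r := irregularity d a
  have hr : r < d := lt_of_le_of_lt (irregularity_le (d := d) (a := a)) (by omega)
  set c := tailMean d r a
  set μ := truncatedSpectrum r hdm a
  have hc : 0 ≤ c := tailMean_nonneg hr.le fun i => (ha_pos i).le
  have hμ : ∀ j, 0 ≤ μ j := by
    intro j
    simp only [μ, truncatedSpectrum]
    split_ifs
    exacts [hc, (ha_pos _).le]
  have hφ' : ∀ i, ‖φ i‖ ^ 2 = a i := hφ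
  obtain ⟨u, l, hu, hl⟩ := exists_eigenbasis_frameOp φ
  obtain ⟨e, he⟩ := exists_orthonormalBasis_sum_norm_sq_le hdm φ
  set x : Fin d → ℝ := fun j => (inner ℂ (e j) (frameOp φ (e j))).re
  have hx : ∀ j, 0 ≤ x j := by
    intro j
    simp only [x, inner_frameOp, Complex.ofReal_re]
    positivity
  have hxsum : ∑ j, x j = ∑ i, a i := by
    rw [sum_inner_frameOp]
    exact Finset.sum_congr rfl fun i _ => hφ' i
  choose! g _ _ hg using fun (t : ℝ) (ht : 0 ≤ t) => hf_conv.exists_isSubgradientAt hf_mono ht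
  have hgmono : ∀ s t, 0 ≤ s → s ≤ t → g s ≤ g t := by
    intro s t hs hst
    rcases hst.eq_or_lt with rfl | h
    · exact le_rfl
    · exact (hg s hs).le_of_lt hs h (hg t (hs.trans hst))
  have hzero : ∑ j, (x j - μ j) = 0 := by
    rw [Finset.sum_sub_distrib, hxsum, sum_truncatedSpectrum hr, sub_self]
  have hhead : ∀ k : Fin r, μ (Fin.castLE hr.le k) = a (Fin.castLE (hr.le.trans hdm) k) := by
    intro k
    simp [μ, truncatedSpectrum]
  -- Since `x` and `μ` have the same sum, subtracting `g c` changes nothing; it kills the tail and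
  -- leaves nonnegative decreasing weights on the head.
  have habel : 0 ≤ ∑ j, (g (μ j) - g c) * (x j - μ j) := by
    rw [← Fin.sum_castLE_add_sum_subtype hr.le]
    have htail : ∑ j : {j : Fin d // r ≤ (j : ℕ)}, (g (μ j) - g c) * (x j - μ j) = 0 := by
      refine Finset.sum_eq_zero fun j _ => ?_
      rw [show μ j = c from if_pos j.2, sub_self, zero_mul]
    rw [htail, add_zero]
    have h1 := mul_sum_le_sum_mul_of_antitone (r := r) (c := 0)
      (fun k => g (μ (Fin.castLE hr.le k)) - g c)
      (fun k => x (Fin.castLE hr.le k) - μ (Fin.castLE hr.le k)) ?_ ?_ ?_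
    · simpa using h1
    · intro i j hij
      refine sub_le_sub_right (hgmono _ _ (hμ _) ?_) _
      rw [hhead, hhead]
      exact ha (Fin.le_def.2 hij)
    · intro k hk
      rw [Finset.sum_sub_distrib, sub_nonneg]
      refine le_trans (le_of_eq ?_) (he k (hk.trans hr.le))
      refine Finset.sum_congr rfl fun i _ => ?_
      rw [hhead, hφ']
      rfl
    · intro k
      refine sub_nonneg.2 (hgmono _ _ hc ?_)
      rw [hhead]
      exact (tailMean_irregularity_lt hd ha _ k.2).le
  calc ∑ j, f (μ j) ≤ ∑ j, f (μ j) + ∑ j, (g (μ j) - g c) * (x j - μ j) :=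
        le_add_of_nonneg_right habel
    _ = ∑ j, (f (μ j) + g (μ j) * (x j - μ j)) - g c * ∑ j, (x j - μ j) := by
        rw [Finset.mul_sum, ← Finset.sum_sub_distrib, ← Finset.sum_add_distrib]
        exact Finset.sum_congr rfl fun j _ => by ring
    _ = ∑ j, (f (μ j) + g (μ j) * (x j - μ j)) := by rw [hzero, mul_zero, sub_zero]
    _ ≤ ∑ j, f (x j) := Finset.sum_le_sum fun j _ => hg _ (hμ j) _ (hx j)
    _ ≤ framePotential f (frameOp φ) :=
        sum_le_framePotential hf_conv (isPositive_frameOp φ).isSelfAdjoint u hu hl e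

theorem HasMinimizerForm.isMinOn {f : ℝ → ℝ} (hf_mono : MonotoneOn f (Set.Ici 0))
    (hf_conv : ConvexOn ℝ (Set.Ici 0) f) (hd : 0 < d) (hdm : d ≤ m)
    (ha_pos : ∀ i, 0 < a i) (ha : Antitone a) {φ : Fin m → EuclideanSpace ℂ (Fin d)}
    (h : HasMinimizerForm a φ) : IsMinOn (framePotential f) (frameOps d a) (frameOp φ) := by
  rintro _ ⟨ψ, hψ, rfl⟩
  obtain ⟨e, he⟩ := h.exists_eigenbasis hdm ha_pos
  change framePotential f (frameOp φ) ≤ framePotential f (frameOp ψ)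
  rw [framePotential_eq_sum f (isPositive_frameOp φ).isSelfAdjoint e he]
  exact sum_truncatedSpectrum_le_framePotential hf_mono hf_conv hd hdm ha_pos ha hψ

end GlobalMin

/-! ### A stationarity condition for nonsmooth `f`. -/

section FirstOrder

variable {m d : ℕ}

theorem Orthonormal.exists_orthonormalBasis_eq {e : Fin d → EuclideanSpace ℂ (Fin d)}
    (he : Orthonormal ℂ e) :
    ∃ b : OrthonormalBasis (Fin d) ℂ (EuclideanSpace ℂ (Fin d)), ∀ j, b j = e j :=
  ⟨OrthonormalBasis.mk he
    (he.linearIndependent.span_eq_top_of_card_eq_finrank' (by simp)).ge, fun j => by simp⟩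

theorem tendsto_clm_apply {ι : Type*} {L : Filter ι}
    {T : ι → EuclideanSpace ℂ (Fin d) →L[ℂ] EuclideanSpace ℂ (Fin d)}
    {x : ι → EuclideanSpace ℂ (Fin d)}
    {T₀ : EuclideanSpace ℂ (Fin d) →L[ℂ] EuclideanSpace ℂ (Fin d)} {x₀ : EuclideanSpace ℂ (Fin d)}
    (hT : Tendsto T L (𝓝 T₀)) (hx : Tendsto x L (𝓝 x₀)) :
    Tendsto (fun n => T n (x n)) L (𝓝 (T₀ x₀)) :=
  (isBoundedBilinearMap_apply.continuous.tendsto (T₀, x₀)).comp (hT.prodMk_nhds hx)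

/-- The scale `t n` is arbitrary so that the result covers first-order and second-order
perturbations alike. The limiting eigenbasis depends on the perturbation, which resolves degenerate
eigenvalues. -/
theorem exists_isSubgradientAt_sum_nonneg {f : ℝ → ℝ} (hf_nonneg : ∀ x ∈ Set.Ici (0 : ℝ), 0 ≤ f x)
    (hf_mono : MonotoneOn f (Set.Ici 0)) (hf_conv : ConvexOn ℝ (Set.Ici 0) f)
    {φ : Fin m → EuclideanSpace ℂ (Fin d)} {ψ : ℕ → Fin m → EuclideanSpace ℂ (Fin d)}
    {t : ℕ → ℝ} (ht : ∀ n, 0 < t n) (ht0 : Tendsto t atTop (𝓝 0))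
    {Δ : EuclideanSpace ℂ (Fin d) →L[ℂ] EuclideanSpace ℂ (Fin d)}
    (hΔ : Tendsto (fun n => (t n : ℂ)⁻¹ • (frameOp (ψ n) - frameOp φ)) atTop (𝓝 Δ))
    (hmin : ∀ᶠ n in atTop, framePotential f (frameOp φ) ≤ framePotential f (frameOp (ψ n))) :
    ∃ (e : OrthonormalBasis (Fin d) ℂ (EuclideanSpace ℂ (Fin d))) (l g : Fin d → ℝ),
      (∀ j, frameOp φ (e j) = (l j : ℂ) • e j) ∧ (∀ j, 0 ≤ l j) ∧
      (∀ j, IsSubgradientAt f (l j) (g j)) ∧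
      0 ≤ ∑ j, g j * (inner ℂ (e j) (Δ (e j))).re := by
  have hS : Tendsto (fun n => frameOp (ψ n)) atTop (𝓝 (frameOp φ)) := by
    have htc : Tendsto (fun n => (t n : ℂ)) atTop (𝓝 0) := by
      have := (Complex.continuous_ofReal.tendsto 0).comp ht0
      rwa [Complex.ofReal_zero] at this
    have h1 := (tendsto_const_nhds (x := frameOp φ)).add (htc.smul hΔ)
    rw [show (0 : ℂ) • Δ = 0 from zero_smul ℂ Δ, add_zero] at h1
    refine h1.congr fun n => ?_
    rw [smul_smul, mul_inv_cancel₀ (by exact_mod_cast (ht n).ne'), one_smul, add_sub_cancel]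
  choose u l hu hl using fun n => exists_eigenbasis_frameOp (ψ n)
  choose g hg0 hgle hg using fun n j => hf_conv.exists_isSubgradientAt hf_mono (hl n j)
  obtain ⟨R, hR⟩ : ∃ R, ∀ n, ‖frameOp (ψ n)‖ ≤ R := by
    obtain ⟨R, hR⟩ := hS.norm.bddAbove_range
    exact ⟨R, fun n => hR ⟨n, rfl⟩⟩
  have hlR : ∀ n j, l n j ≤ R := by
    intro n j
    have h1 := (frameOp (ψ n)).le_opNorm (u n j)
    rw [hu, norm_smul, Complex.norm_real, Real.norm_of_nonneg (hl n j)] at h1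
    simp only [OrthonormalBasis.norm_eq_one, mul_one] at h1
    exact h1.trans (hR n)
  have hR0 : 0 ≤ R := (norm_nonneg _).trans (hR 0)
  have hgR : ∀ n j, g n j ≤ f (R + 1) := by
    intro n j
    have h1 := hl n j
    have h2 : f (l n j + 1) ≤ f (R + 1) :=
      hf_mono (show 0 ≤ l n j + 1 by linarith) (show 0 ≤ R + 1 by linarith)
        (by linarith [hlR n j])
    linarith [hgle n j, hf_nonneg (l n j) h1]
  -- Eigenvectors, eigenvalues and subgradients are bundled so that one subsequence makes them all
  -- converge.
  set Z : ℕ → Fin d → EuclideanSpace ℂ (Fin d) × ℝ × ℝ := fun n j => (u n j, l n j, g n j)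
  have hfR : 0 ≤ f (R + 1) := hf_nonneg _ (show 0 ≤ R + 1 by linarith)
  have hZ : ∀ n, Z n ∈ Metric.closedBall
      (0 : Fin d → EuclideanSpace ℂ (Fin d) × ℝ × ℝ) (1 + R + f (R + 1)) := by
    intro n
    rw [mem_closedBall_zero_iff, pi_norm_le_iff_of_nonneg (by positivity)]
    intro j
    refine max_le ?_ (max_le ?_ ?_)
    · simp only [Z, OrthonormalBasis.norm_eq_one]
      linarith
    · simp only [Z, Real.norm_of_nonneg (hl n j)]
      linarith [hlR n j]
    · simp only [Z, Real.norm_of_nonneg (hg0 n j)]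
      linarith [hgR n j]
  obtain ⟨z, -, k, hk, hlim⟩ := tendsto_subseq_of_bounded Metric.isBounded_closedBall hZ
  have hlim' := fun j => (tendsto_pi_nhds.1 hlim j)
  have hue : ∀ j, Tendsto (fun n => u (k n) j) atTop (𝓝 (z j).1) := fun j =>
    (continuous_fst.tendsto _).comp (hlim' j)
  have hll : ∀ j, Tendsto (fun n => l (k n) j) atTop (𝓝 (z j).2.1) := fun j =>
    ((continuous_fst.comp continuous_snd).tendsto _).comp (hlim' j)
  have hgg : ∀ j, Tendsto (fun n => g (k n) j) atTop (𝓝 (z j).2.2) := fun j =>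
    ((continuous_snd.comp continuous_snd).tendsto _).comp (hlim' j)
  have horth : Orthonormal ℂ fun j => (z j).1 := by
    rw [orthonormal_iff_ite]
    intro i j
    refine tendsto_nhds_unique ((hue i).inner (hue j)) ?_
    refine tendsto_const_nhds.congr fun n => ?_
    exact (orthonormal_iff_ite.1 (u (k n)).orthonormal i j).symm
  obtain ⟨e, he⟩ := horth.exists_orthonormalBasis_eq
  have hl0 : ∀ j, 0 ≤ (z j).2.1 := fun j => ge_of_tendsto' (hll j) fun n => hl _ j
  refine ⟨e, fun j => (z j).2.1, fun j => (z j).2.2, fun j => ?_, hl0, fun j y hy => ?_, ?_⟩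
  · rw [he]
    refine tendsto_nhds_unique (tendsto_clm_apply (hS.comp hk.tendsto_atTop) (hue j)) ?_
    refine Tendsto.congr (fun n => (hu (k n) j).symm) ?_
    exact ((Complex.continuous_ofReal.tendsto _).comp (hll j)).smul (hue j)
  -- A supporting line at the limit eigenvalue bounds `f` from below along the sequence, in place of
  -- continuity of `f`.
  · obtain ⟨γ, -, -, hγ⟩ := hf_conv.exists_isSubgradientAt hf_mono (hl0 j)
    have h1 : Tendsto (fun n => f (z j).2.1 + γ * (l (k n) j - (z j).2.1) +
        g (k n) j * (y - l (k n) j)) atTop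
        (𝓝 (f (z j).2.1 + γ * ((z j).2.1 - (z j).2.1) + (z j).2.2 * (y - (z j).2.1))) :=
      (tendsto_const_nhds.add (tendsto_const_nhds.mul ((hll j).sub tendsto_const_nhds))).add
        ((hgg j).mul (tendsto_const_nhds.sub (hll j)))
    rw [sub_self, mul_zero, add_zero] at h1
    refine le_of_tendsto' h1 fun n => ?_
    linarith [hγ (l (k n) j) (hl _ _), hg (k n) j y hy]
  · simp only [he]
    have h1 : Tendsto (fun n => ∑ j, g (k n) j * (inner ℂ (u (k n) j)
        (((t (k n) : ℂ)⁻¹ • (frameOp (ψ (k n)) - frameOp φ)) (u (k n) j))).re) atTop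
        (𝓝 (∑ j, (z j).2.2 * (inner ℂ (z j).1 (Δ (z j).1)).re)) :=
      tendsto_finsetSum _ fun j _ => (hgg j).mul ((Complex.continuous_re.tendsto _).comp
        ((hue j).inner (tendsto_clm_apply (hΔ.comp hk.tendsto_atTop) (hue j))))
    refine ge_of_tendsto h1 ?_
    filter_upwards [hk.tendsto_atTop.eventually hmin] with n hn
    obtain ⟨v, w, hv, hw⟩ := exists_eigenbasis_frameOp φ
    -- Jensen is applied to the unperturbed operator in the eigenbasis of the perturbed one, so that
    -- both are compared through their diagonals in a single basis.
    have h2 := sum_le_framePotential hf_conv (isPositive_frameOp φ).isSelfAdjoint v hv hw (u (k n))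
    rw [framePotential_eq_sum f (isPositive_frameOp (ψ (k n))).isSelfAdjoint (u (k n))
      (hu (k n))] at hn
    have h3 : ∀ j, (inner ℂ (u (k n) j)
        (((t (k n) : ℂ)⁻¹ • (frameOp (ψ (k n)) - frameOp φ)) (u (k n) j))).re =
        (t (k n))⁻¹ * (l (k n) j - (inner ℂ (u (k n) j) (frameOp φ (u (k n) j))).re) := by
      intro j
      rw [smul_apply, sub_apply, hu, inner_smul_right, inner_sub_right, inner_smul_right,
        inner_self_eq_norm_sq_to_K, OrthonormalBasis.norm_eq_one, ← Complex.ofReal_inv,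
        Complex.re_ofReal_mul]
      simp
    have h4 : ∀ j, f (l (k n) j) - f (inner ℂ (u (k n) j) (frameOp φ (u (k n) j))).re ≤
        g (k n) j * (l (k n) j - (inner ℂ (u (k n) j) (frameOp φ (u (k n) j))).re) := by
      intro j
      have h5 : 0 ≤ (inner ℂ (u (k n) j) (frameOp φ (u (k n) j))).re := by
        rw [inner_frameOp, Complex.ofReal_re]
        positivity
      linarith [hg (k n) j _ h5]
    have h6 := Finset.sum_le_sum fun j (_ : j ∈ Finset.univ) => h4 j
    rw [Finset.sum_sub_distrib] at h6
    calc 0 ≤ (t (k n))⁻¹ * ∑ j, g (k n) j *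
          (l (k n) j - (inner ℂ (u (k n) j) (frameOp φ (u (k n) j))).re) :=
          mul_nonneg (inv_nonneg.2 (ht _).le) (by linarith)
      _ = _ := by
          rw [Finset.mul_sum]
          refine Finset.sum_congr rfl fun j _ => ?_
          rw [h3]
          ring

end FirstOrder

/-! ### Perturbations that preserve the norms, expanded to second order. -/

section Perturbation

variable {m d : ℕ} {a : Fin m → ℝ}

/-- The family obtained by moving each `φ i` on its sphere in the direction `η i`. -/
noncomputable def sphericalPerturbation (φ η : Fin m → EuclideanSpace ℂ (Fin d)) (t : ℝ)
    (i : Fin m) : EuclideanSpace ℂ (Fin d) :=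
  (Real.sqrt (1 - t ^ 2 * (‖η i‖ ^ 2 / ‖φ i‖ ^ 2)) : ℂ) • φ i + (t : ℂ) • η i

theorem norm_sq_sphericalPerturbation {φ η : Fin m → EuclideanSpace ℂ (Fin d)} {t : ℝ} {i : Fin m}
    (hφ : φ i ≠ 0) (hη : inner ℂ (φ i) (η i) = 0)
    (ht : t ^ 2 * (‖η i‖ ^ 2 / ‖φ i‖ ^ 2) ≤ 1) :
    ‖sphericalPerturbation φ η t i‖ ^ 2 = ‖φ i‖ ^ 2 := by
  have h0 : ‖φ i‖ ≠ 0 := norm_ne_zero_iff.2 hφ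
  rw [sphericalPerturbation, sq, norm_add_sq_eq_norm_sq_add_norm_sq_of_inner_eq_zero (𝕜 := ℂ), norm_smul,
    norm_smul, Complex.norm_real, Complex.norm_real, Real.norm_eq_abs, Real.norm_eq_abs]
  · calc _ = |Real.sqrt (1 - t ^ 2 * (‖η i‖ ^ 2 / ‖φ i‖ ^ 2))| ^ 2 * ‖φ i‖ ^ 2 +
        |t| ^ 2 * ‖η i‖ ^ 2 := by ring
      _ = _ := by
        rw [sq_abs, sq_abs, Real.sq_sqrt (by linarith)]
        field_simp
        ring
  · rw [inner_smul_left, inner_smul_right, hη]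
    simp

theorem eventually_sq_mul_lt_one (φ η : Fin m → EuclideanSpace ℂ (Fin d)) :
    ∀ᶠ t in 𝓝 (0 : ℝ), ∀ i, t ^ 2 * (‖η i‖ ^ 2 / ‖φ i‖ ^ 2) < 1 := by
  rw [eventually_all]
  intro i
  have hc : Continuous fun t : ℝ => t ^ 2 * (‖η i‖ ^ 2 / ‖φ i‖ ^ 2) := by fun_prop
  exact hc.continuousAt.eventually_lt continuousAt_const (by simp)

theorem eventually_sphericalPerturbation_mem {φ η : Fin m → EuclideanSpace ℂ (Fin d)}
    (hφ : φ ∈ normSeqs d a) (hφ0 : ∀ i, φ i ≠ 0) (hη : ∀ i, inner ℂ (φ i) (η i) = 0) :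
    ∀ᶠ t in 𝓝 (0 : ℝ), sphericalPerturbation φ η t ∈ normSeqs d a := by
  filter_upwards [eventually_sq_mul_lt_one φ η] with t ht i
  rw [norm_sq_sphericalPerturbation (hφ0 i) (hη i) (ht i).le]
  exact hφ i

theorem frameOp_sphericalPerturbation_sub (φ η : Fin m → EuclideanSpace ℂ (Fin d)) (t : ℝ) :
    frameOp (sphericalPerturbation φ η t) - frameOp φ =
      ∑ i, (((Real.sqrt (1 - t ^ 2 * (‖η i‖ ^ 2 / ‖φ i‖ ^ 2)) : ℂ) ^ 2 - 1) •
          rankOne ℂ (φ i) (φ i) +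
        ((Real.sqrt (1 - t ^ 2 * (‖η i‖ ^ 2 / ‖φ i‖ ^ 2)) : ℂ) * t) •
          (rankOne ℂ (φ i) (η i) + rankOne ℂ (η i) (φ i)) +
        (t : ℂ) ^ 2 • rankOne ℂ (η i) (η i)) := by
  rw [frameOp_eq_sum_rankOne, frameOp_eq_sum_rankOne, ← Finset.sum_sub_distrib]
  refine Finset.sum_congr rfl fun i _ => ?_
  simp only [sphericalPerturbation, map_add, add_apply, map_smul,
    map_smulₛₗ, smul_apply, Complex.conj_ofReal]
  module

theorem continuous_frameOp_sphericalPerturbation (φ η : Fin m → EuclideanSpace ℂ (Fin d)) :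
    Continuous fun t : ℝ => frameOp (sphericalPerturbation φ η t) := by
  have h : (fun t : ℝ => frameOp (sphericalPerturbation φ η t)) =
      fun t => (frameOp (sphericalPerturbation φ η t) - frameOp φ) + frameOp φ := by
    simp
  rw [h]
  simp only [frameOp_sphericalPerturbation_sub]
  fun_prop

theorem IsLocalMinOn.eventually_le_sphericalPerturbation {f : ℝ → ℝ}
    {φ η : Fin m → EuclideanSpace ℂ (Fin d)}
    (hmin : IsLocalMinOn (framePotential f) (frameOps d a) (frameOp φ))
    (hφ : φ ∈ normSeqs d a) (hφ0 : ∀ i, φ i ≠ 0) (hη : ∀ i, inner ℂ (φ i) (η i) = 0) :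
    ∀ᶠ t in 𝓝 (0 : ℝ), framePotential f (frameOp φ) ≤
      framePotential f (frameOp (sphericalPerturbation φ η t)) := by
  have h0 : sphericalPerturbation φ η 0 = φ := by
    ext1 i
    simp [sphericalPerturbation]
  have h1 : Tendsto (fun t : ℝ => frameOp (sphericalPerturbation φ η t)) (𝓝 0)
      (𝓝[frameOps d a] (frameOp φ)) := by
    refine tendsto_nhdsWithin_iff.2 ⟨?_, ?_⟩
    · have := (continuous_frameOp_sphericalPerturbation φ η).tendsto 0
      rwa [h0] at this
    · filter_upwards [eventually_sphericalPerturbation_mem hφ hφ0 hη] with t ht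
      exact ⟨_, ht, rfl⟩
  exact h1.eventually hmin

theorem tendsto_inv_smul_frameOp_sphericalPerturbation_sub
    (φ η : Fin m → EuclideanSpace ℂ (Fin d)) :
    Tendsto (fun t : ℝ => (t : ℂ)⁻¹ • (frameOp (sphericalPerturbation φ η t) - frameOp φ))
      (𝓝[≠] 0) (𝓝 (∑ i, (rankOne ℂ (φ i) (η i) + rankOne ℂ (η i) (φ i)))) := by
  set h : ℝ → EuclideanSpace ℂ (Fin d) →L[ℂ] EuclideanSpace ℂ (Fin d) := fun t =>
    ∑ i, ((-(t * (‖η i‖ ^ 2 / ‖φ i‖ ^ 2) : ℝ) : ℂ) • rankOne ℂ (φ i) (φ i) +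
        (Real.sqrt (1 - t ^ 2 * (‖η i‖ ^ 2 / ‖φ i‖ ^ 2)) : ℂ) •
          (rankOne ℂ (φ i) (η i) + rankOne ℂ (η i) (φ i)) +
        (t : ℂ) • rankOne ℂ (η i) (η i))
  have hc : Continuous h := by fun_prop
  have h0 : h 0 = ∑ i, (rankOne ℂ (φ i) (η i) + rankOne ℂ (η i) (φ i)) := by simp [h]
  rw [← h0]
  refine ((hc.tendsto 0).mono_left nhdsWithin_le_nhds).congr' ?_
  filter_upwards [(eventually_sq_mul_lt_one φ η).filter_mono nhdsWithin_le_nhds,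
    self_mem_nhdsWithin] with t ht ht0
  have ht0' : (t : ℂ) ≠ 0 := by exact_mod_cast ht0
  rw [frameOp_sphericalPerturbation_sub, Finset.smul_sum]
  refine Finset.sum_congr rfl fun i _ => ?_
  have hs : ((Real.sqrt (1 - t ^ 2 * (‖η i‖ ^ 2 / ‖φ i‖ ^ 2)) : ℂ)) ^ 2 =
      ((1 - t ^ 2 * (‖η i‖ ^ 2 / ‖φ i‖ ^ 2) : ℝ) : ℂ) := by
    rw [← Complex.ofReal_pow, Real.sq_sqrt (by linarith [ht i])]
  rw [hs]
  match_scalars <;> field_simp <;> ring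

theorem tendsto_inv_sq_smul_frameOp_sphericalPerturbation_sub
    {φ η : Fin m → EuclideanSpace ℂ (Fin d)}
    (hzero : ∑ i, (rankOne ℂ (φ i) (η i) + rankOne ℂ (η i) (φ i)) = 0) :
    Tendsto (fun t : ℝ => ((t ^ 2 : ℝ) : ℂ)⁻¹ •
        (frameOp (sphericalPerturbation φ η t) - frameOp φ)) (𝓝[≠] 0)
      (𝓝 (∑ i, (-((‖η i‖ ^ 2 / ‖φ i‖ ^ 2 : ℝ) : ℂ) • rankOne ℂ (φ i) (φ i) +
        rankOne ℂ (η i) (η i)))) := by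
  set s : Fin m → ℝ → ℝ := fun i t => Real.sqrt (1 - t ^ 2 * (‖η i‖ ^ 2 / ‖φ i‖ ^ 2))
  set h : ℝ → EuclideanSpace ℂ (Fin d) →L[ℂ] EuclideanSpace ℂ (Fin d) := fun t =>
    ∑ i, (-((‖η i‖ ^ 2 / ‖φ i‖ ^ 2 : ℝ) : ℂ) • rankOne ℂ (φ i) (φ i) +
        ((-(t * (‖η i‖ ^ 2 / ‖φ i‖ ^ 2)) / (s i t + 1) : ℝ) : ℂ) •
          (rankOne ℂ (φ i) (η i) + rankOne ℂ (η i) (φ i)) +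
        rankOne ℂ (η i) (η i))
  have hs1 : ∀ i t, s i t + 1 ≠ 0 := fun i t => by positivity
  have hc : Continuous h := by
    have hsc : ∀ i, Continuous (s i) := fun i => by fun_prop
    have : ∀ i, Continuous fun t => -(t * (‖η i‖ ^ 2 / ‖φ i‖ ^ 2)) / (s i t + 1) := fun i =>
      Continuous.div (by fun_prop) ((hsc i).add continuous_const) (hs1 i)
    fun_prop
  have h0 : h 0 = ∑ i, (-((‖η i‖ ^ 2 / ‖φ i‖ ^ 2 : ℝ) : ℂ) • rankOne ℂ (φ i) (φ i) +
      rankOne ℂ (η i) (η i)) := by simp [h]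
  rw [← h0]
  refine ((hc.tendsto 0).mono_left nhdsWithin_le_nhds).congr' ?_
  filter_upwards [(eventually_sq_mul_lt_one φ η).filter_mono nhdsWithin_le_nhds,
    self_mem_nhdsWithin] with t ht ht0
  have ht0r : t ≠ 0 := ht0
  have ht0' : (t : ℂ) ≠ 0 := by exact_mod_cast ht0
  -- Subtracting the vanishing first-order term turns the cross coefficient `s t` into `(s - 1) t`,
  -- which is `O(t³)`; rationalizing `s - 1` below shows that it disappears after division by `t²`.
  have hsub : frameOp (sphericalPerturbation φ η t) - frameOp φ =
      frameOp (sphericalPerturbation φ η t) - frameOp φ -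
        (t : ℂ) • ∑ i, (rankOne ℂ (φ i) (η i) + rankOne ℂ (η i) (φ i)) := by
    rw [hzero, smul_zero, sub_zero]
  rw [hsub, frameOp_sphericalPerturbation_sub, Finset.smul_sum, ← Finset.sum_sub_distrib,
    Finset.smul_sum]
  refine Finset.sum_congr rfl fun i _ => ?_
  have hs : s i t ^ 2 = 1 - t ^ 2 * (‖η i‖ ^ 2 / ‖φ i‖ ^ 2) :=
    Real.sq_sqrt (by linarith [ht i])
  have hsC : ((s i t : ℝ) : ℂ) ^ 2 = ((1 - t ^ 2 * (‖η i‖ ^ 2 / ‖φ i‖ ^ 2) : ℝ) : ℂ) := by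
    rw [← Complex.ofReal_pow, hs]
  have hq : -(t * (‖η i‖ ^ 2 / ‖φ i‖ ^ 2)) / (s i t + 1) = (t ^ 2)⁻¹ * (s i t * t - t) := by
    rw [div_eq_iff (hs1 i t)]
    field_simp
    linear_combination -hs
  rw [hq]
  change _ = ((t ^ 2 : ℝ) : ℂ)⁻¹ • (((s i t : ℂ) ^ 2 - 1) • _ + ((s i t : ℂ) * t) • _ + _ - _)
  rw [hsC]
  push_cast
  match_scalars <;> field_simp <;> ring

end Perturbation

/-! ### First- and second-order consequences of local minimality. -/

section LocalMin

variable {m d : ℕ} {a : Fin m → ℝ}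

theorem inner_frameOp_eigenvector {φ : Fin m → EuclideanSpace ℂ (Fin d)}
    {e : EuclideanSpace ℂ (Fin d)} {l : ℝ} (he : frameOp φ e = (l : ℂ) • e)
    (x : EuclideanSpace ℂ (Fin d)) : inner ℂ e (frameOp φ x) = l * inner ℂ e x := by
  have h1 : inner ℂ (frameOp φ e) x = inner ℂ e (frameOp φ x) := isSymmetric_frameOp φ e x
  rw [← h1, he, inner_smul_left, Complex.conj_ofReal]

theorem inner_eq_zero_of_eigenvalue_ne {φ : Fin m → EuclideanSpace ℂ (Fin d)}
    {x y : EuclideanSpace ℂ (Fin d)} {l μ : ℝ} (hx : frameOp φ x = (l : ℂ) • x)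
    (hy : frameOp φ y = (μ : ℂ) • y) (hne : l ≠ μ) : inner ℂ x y = 0 := by
  have h1 := inner_frameOp_eigenvector hx y
  rw [hy, inner_smul_right] at h1
  have h2 : ((l : ℂ) - μ) * inner ℂ x y = 0 := by linear_combination -h1
  rcases mul_eq_zero.1 h2 with h | h
  · exact absurd (by exact_mod_cast sub_eq_zero.1 h) hne
  · exact h

theorem frameOp_apply_eq_smul_of_inner_eq_zero {φ : Fin m → EuclideanSpace ℂ (Fin d)}
    {e : OrthonormalBasis (Fin d) ℂ (EuclideanSpace ℂ (Fin d))} {l : Fin d → ℝ}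
    (he : ∀ j, frameOp φ (e j) = (l j : ℂ) • e j) {x : EuclideanSpace ℂ (Fin d)} {c : ℝ}
    (hx : ∀ j, l j ≠ c → inner ℂ (e j) x = 0) : frameOp φ x = (c : ℂ) • x := by
  conv_lhs => rw [← e.sum_repr' x]
  conv_rhs => rw [← e.sum_repr' x]
  rw [map_sum, Finset.smul_sum]
  refine Finset.sum_congr rfl fun j _ => ?_
  rw [map_smul, he]
  by_cases h : l j = c
  · rw [h, smul_comm]
  · simp [hx j h]

theorem tendsto_one_div_add_atTop_nhdsNE :
    Tendsto (fun n : ℕ => (1 : ℝ) / ((n : ℝ) + 1)) atTop (𝓝[≠] 0) :=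
  tendsto_nhdsWithin_iff.2 ⟨tendsto_one_div_add_atTop_nhds_zero_nat,
    Eventually.of_forall fun _ => (Nat.one_div_pos_of_nat (α := ℝ)).ne'⟩

variable {f : ℝ → ℝ} {φ η : Fin m → EuclideanSpace ℂ (Fin d)}

theorem IsLocalMinOn.exists_first_order (hf_nonneg : ∀ x ∈ Set.Ici (0 : ℝ), 0 ≤ f x)
    (hf_mono : MonotoneOn f (Set.Ici 0)) (hf_conv : ConvexOn ℝ (Set.Ici 0) f)
    (hmin : IsLocalMinOn (framePotential f) (frameOps d a) (frameOp φ))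
    (hφ : φ ∈ normSeqs d a) (hφ0 : ∀ i, φ i ≠ 0) (hη : ∀ i, inner ℂ (φ i) (η i) = 0) :
    ∃ (e : OrthonormalBasis (Fin d) ℂ (EuclideanSpace ℂ (Fin d))) (l g : Fin d → ℝ),
      (∀ j, frameOp φ (e j) = (l j : ℂ) • e j) ∧ (∀ j, 0 ≤ l j) ∧
      (∀ j, IsSubgradientAt f (l j) (g j)) ∧
      0 ≤ ∑ j, g j * ∑ i, (inner ℂ (e j) (φ i) * inner ℂ (η i) (e j)).re := by
  have ht := tendsto_one_div_add_atTop_nhdsNE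
  obtain ⟨e, l, g, he, hl, hg, hsum⟩ := exists_isSubgradientAt_sum_nonneg hf_nonneg hf_mono hf_conv
    (fun n => Nat.one_div_pos_of_nat (α := ℝ)) (tendsto_nhdsWithin_iff.1 ht).1
    ((tendsto_inv_smul_frameOp_sphericalPerturbation_sub φ η).comp ht)
    ((ht.mono_right nhdsWithin_le_nhds).eventually
      (hmin.eventually_le_sphericalPerturbation hφ hφ0 hη))
  refine ⟨e, l, g, he, hl, hg, ?_⟩
  have h1 : ∀ j, (inner ℂ (e j)
      ((∑ i, (rankOne ℂ (φ i) (η i) + rankOne ℂ (η i) (φ i))) (e j))).re =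
      2 * ∑ i, (inner ℂ (e j) (φ i) * inner ℂ (η i) (e j)).re := by
    intro j
    rw [sum_apply, inner_sum, Complex.re_sum, Finset.mul_sum]
    refine Finset.sum_congr rfl fun i _ => ?_
    rw [add_apply, rankOne_apply, rankOne_apply, inner_add_right, inner_smul_right,
      inner_smul_right, ← inner_conj_symm (φ i), ← inner_conj_symm (e j) (η i), Complex.add_re,
      ← map_mul, Complex.conj_re, mul_comm (inner ℂ (η i) (e j))]
    ring
  simp only [h1, mul_left_comm _ (2 : ℝ), ← Finset.mul_sum] at hsum
  linarith

theorem IsLocalMinOn.exists_second_order (hf_nonneg : ∀ x ∈ Set.Ici (0 : ℝ), 0 ≤ f x)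
    (hf_mono : MonotoneOn f (Set.Ici 0)) (hf_conv : ConvexOn ℝ (Set.Ici 0) f)
    (hmin : IsLocalMinOn (framePotential f) (frameOps d a) (frameOp φ))
    (hφ : φ ∈ normSeqs d a) (hφ0 : ∀ i, φ i ≠ 0) (hη : ∀ i, inner ℂ (φ i) (η i) = 0)
    (hzero : ∑ i, (rankOne ℂ (φ i) (η i) + rankOne ℂ (η i) (φ i)) = 0) :
    ∃ (e : OrthonormalBasis (Fin d) ℂ (EuclideanSpace ℂ (Fin d))) (l g : Fin d → ℝ),
      (∀ j, frameOp φ (e j) = (l j : ℂ) • e j) ∧ (∀ j, 0 ≤ l j) ∧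
      (∀ j, IsSubgradientAt f (l j) (g j)) ∧
      ∑ i, ‖η i‖ ^ 2 / ‖φ i‖ ^ 2 * ∑ j, g j * ‖inner ℂ (e j) (φ i)‖ ^ 2 ≤
        ∑ i, ∑ j, g j * ‖inner ℂ (e j) (η i)‖ ^ 2 := by
  have ht := tendsto_one_div_add_atTop_nhdsNE
  have ht0 : Tendsto (fun n : ℕ => ((1 : ℝ) / ((n : ℝ) + 1)) ^ 2) atTop (𝓝 0) := by
    have := (tendsto_nhdsWithin_iff.1 ht).1.pow 2
    rwa [zero_pow two_ne_zero] at this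
  obtain ⟨e, l, g, he, hl, hg, hsum⟩ := exists_isSubgradientAt_sum_nonneg hf_nonneg hf_mono hf_conv
    (fun n => pow_pos (Nat.one_div_pos_of_nat (α := ℝ) (n := n)) 2) ht0
    ((tendsto_inv_sq_smul_frameOp_sphericalPerturbation_sub hzero).comp ht)
    ((ht.mono_right nhdsWithin_le_nhds).eventually
      (hmin.eventually_le_sphericalPerturbation hφ hφ0 hη))
  refine ⟨e, l, g, he, hl, hg, ?_⟩
  have hself : ∀ x y : EuclideanSpace ℂ (Fin d),
      inner ℂ x (rankOne ℂ y y x) = ((‖inner ℂ x y‖ ^ 2 : ℝ) : ℂ) := by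
    intro x y
    rw [rankOne_apply, inner_smul_right, ← inner_conj_symm, mul_comm, Complex.mul_conj']
    push_cast
    rfl
  have h1 : ∀ j, (inner ℂ (e j) ((∑ i, (-((‖η i‖ ^ 2 / ‖φ i‖ ^ 2 : ℝ) : ℂ) •
      rankOne ℂ (φ i) (φ i) + rankOne ℂ (η i) (η i))) (e j))).re =
      ∑ i, (‖inner ℂ (e j) (η i)‖ ^ 2 -
        ‖η i‖ ^ 2 / ‖φ i‖ ^ 2 * ‖inner ℂ (e j) (φ i)‖ ^ 2) := by
    intro j
    rw [sum_apply, inner_sum, Complex.re_sum]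
    refine Finset.sum_congr rfl fun i _ => ?_
    rw [add_apply, smul_apply, inner_add_right, inner_smul_right, hself, hself, Complex.add_re,
      ← Complex.ofReal_neg, Complex.re_ofReal_mul, Complex.ofReal_re, Complex.ofReal_re]
    ring
  simp only [h1] at hsum
  rw [← sub_nonneg, ← Finset.sum_sub_distrib]
  refine hsum.trans_eq ?_
  simp only [Finset.mul_sum]
  rw [Finset.sum_comm]
  refine Finset.sum_congr rfl fun i _ => ?_
  rw [← Finset.sum_sub_distrib]
  exact Finset.sum_congr rfl fun j _ => by ring

/-- Only `φ i₀` is moved, along the part of `-S φ_{i₀}` tangent to its sphere. A vector spread over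
several eigenspaces would then give strict descent. -/
theorem IsLocalMinOn.exists_eigenvalue (hf_nonneg : ∀ x ∈ Set.Ici (0 : ℝ), 0 ≤ f x)
    (hf_mono : MonotoneOn f (Set.Ici 0)) (hf_strict : StrictConvexOn ℝ (Set.Ici 0) f)
    (hmin : IsLocalMinOn (framePotential f) (frameOps d a) (frameOp φ))
    (hφ : φ ∈ normSeqs d a) (hφ0 : ∀ i, φ i ≠ 0) (i₀ : Fin m) :
    ∃ c : ℝ, 0 ≤ c ∧ frameOp φ (φ i₀) = (c : ℂ) • φ i₀ := by
  classical
  have hn : ‖φ i₀‖ ^ 2 ≠ 0 := pow_ne_zero 2 (norm_ne_zero_iff.2 (hφ0 i₀))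
  have hnC : ((‖φ i₀‖ : ℝ) : ℂ) ^ 2 ≠ 0 := by exact_mod_cast hn
  set q : ℝ := ∑ i, ‖inner ℂ (φ i₀) (φ i)‖ ^ 2
  have hq : inner ℂ (φ i₀) (frameOp φ (φ i₀)) = (q : ℂ) := inner_frameOp φ (φ i₀)
  -- The Rayleigh quotient, the value for which `w` is orthogonal to `φ i₀`.
  set c : ℝ := q / ‖φ i₀‖ ^ 2
  have hc : 0 ≤ c := by positivity
  set w : EuclideanSpace ℂ (Fin d) := (c : ℂ) • φ i₀ - frameOp φ (φ i₀)
  have hw : inner ℂ (φ i₀) w = 0 := by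
    rw [inner_sub_right, hq, inner_smul_right, inner_self_eq_norm_sq_to_K]
    simp only [c]
    push_cast
    exact sub_eq_zero.2 (div_mul_cancel₀ _ hnC)
  obtain ⟨e, l, g, he, hl, hg, hsum⟩ := hmin.exists_first_order (η := Pi.single i₀ w) hf_nonneg
    hf_mono hf_strict.convexOn hφ hφ0 (fun i => by
      by_cases h : i = i₀
      · subst h
        simpa using hw
      · simp [h])
  have h1 : ∀ j, ∑ i, (inner ℂ (e j) (φ i) *
      inner ℂ ((Pi.single i₀ w : Fin m → EuclideanSpace ℂ (Fin d)) i) (e j)).re =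
      -((l j - c) * ‖inner ℂ (e j) (φ i₀)‖ ^ 2) := by
    intro j
    rw [Finset.sum_eq_single i₀]
    · rw [Pi.single_eq_same, ← inner_conj_symm w, inner_sub_right, inner_frameOp_eigenvector (he j),
        inner_smul_right, ← sub_mul, map_mul, mul_left_comm, Complex.mul_conj', map_sub,
        Complex.conj_ofReal, Complex.conj_ofReal, ← Complex.ofReal_sub, Complex.re_ofReal_mul,
        ← Complex.ofReal_pow, Complex.ofReal_re]
      ring
    · intro i _ hi
      simp [hi]
    · simp
  simp only [h1] at hsum
  have hbal : ∑ j, (l j - c) * ‖inner ℂ (e j) (φ i₀)‖ ^ 2 = 0 := by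
    have h2 := inner_apply_self_eq_sum e he (φ i₀)
    rw [hq, Complex.ofReal_re] at h2
    simp only [sub_mul, Finset.sum_sub_distrib]
    rw [← h2, ← Finset.mul_sum, e.sum_sq_norm_inner_right, div_mul_cancel₀ _ hn, sub_self]
  -- The weighted mean of `l j - c` is zero, so `g j` may be replaced by `g j - γ`; by strict
  -- convexity this has the sign of `l j - c`.
  obtain ⟨γ, -, -, hγ⟩ := hf_strict.convexOn.exists_isSubgradientAt hf_mono hc
  have hpos : ∀ j, l j ≠ c → 0 < (g j - γ) * (l j - c) := by
    intro j hj
    rcases lt_or_gt_of_ne hj with h | h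
    · exact mul_pos_of_neg_of_neg
        (sub_neg.2 ((hg j).lt_of_lt hf_strict (hl j) h hγ)) (sub_neg.2 h)
    · exact mul_pos (sub_pos.2 (hγ.lt_of_lt hf_strict hc h (hg j))) (sub_pos.2 h)
  have hnn : ∀ j, 0 ≤ (g j - γ) * (l j - c) * ‖inner ℂ (e j) (φ i₀)‖ ^ 2 := by
    intro j
    by_cases h : l j = c
    · simp [h]
    · exact mul_nonneg (hpos j h).le (by positivity)
  have hle : ∑ j, (g j - γ) * (l j - c) * ‖inner ℂ (e j) (φ i₀)‖ ^ 2 ≤ 0 := by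
    have h3 : ∑ j, (g j - γ) * (l j - c) * ‖inner ℂ (e j) (φ i₀)‖ ^ 2 =
        -∑ j, g j * -((l j - c) * ‖inner ℂ (e j) (φ i₀)‖ ^ 2) -
          γ * ∑ j, (l j - c) * ‖inner ℂ (e j) (φ i₀)‖ ^ 2 := by
      rw [Finset.mul_sum, ← Finset.sum_neg_distrib, ← Finset.sum_sub_distrib]
      exact Finset.sum_congr rfl fun j _ => by ring
    rw [h3, hbal]
    linarith
  have hz := (Finset.sum_eq_zero_iff_of_nonneg fun j _ => hnn j).1
    (hle.antisymm (Finset.sum_nonneg fun j _ => hnn j))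
  refine ⟨c, hc, frameOp_apply_eq_smul_of_inner_eq_zero he fun j hj => ?_⟩
  have h4 := (mul_eq_zero.1 (hz j (Finset.mem_univ j))).resolve_left (hpos j hj).ne'
  simpa using h4

/-- A nontrivial relation cancels the first-order term when each `φ i` moves towards `u`. The
second-order term then shifts trace from the eigenvalues `c i` down to `b`, which lowers the
potential. -/
theorem IsLocalMinOn.coeff_eq_zero (hf_nonneg : ∀ x ∈ Set.Ici (0 : ℝ), 0 ≤ f x)
    (hf_mono : MonotoneOn f (Set.Ici 0)) (hf_strict : StrictConvexOn ℝ (Set.Ici 0) f)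
    (hmin : IsLocalMinOn (framePotential f) (frameOps d a) (frameOp φ))
    (hφ : φ ∈ normSeqs d a) (hφ0 : ∀ i, φ i ≠ 0) {c : Fin m → ℝ}
    (hc : ∀ i, frameOp φ (φ i) = (c i : ℂ) • φ i)
    {u : EuclideanSpace ℂ (Fin d)} (hu : ‖u‖ = 1) {b : ℝ} (hb : 0 ≤ b)
    (hbu : frameOp φ u = (b : ℂ) • u) {z : Fin m → ℂ} (hz : ∀ i, z i ≠ 0 → b < c i)
    (hsum : ∑ i, z i • φ i = 0) (i : Fin m) : z i = 0 := by
  by_contra hi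
  -- `rankOne` is conjugate-linear in its second argument, so the conjugate makes the cross terms
  -- sum to a multiple of `∑ z_i φ_i`.
  set η : Fin m → EuclideanSpace ℂ (Fin d) := fun i => starRingEnd ℂ (z i) • u
  have hη : ∀ i, inner ℂ (φ i) (η i) = 0 := by
    intro i
    simp only [η, inner_smul_right]
    by_cases h : z i = 0
    · simp [h]
    · rw [inner_eq_zero_of_eigenvalue_ne (hc i) hbu (hz i h).ne', mul_zero]
  have hnη : ∀ i, ‖η i‖ = ‖z i‖ := fun i => by simp [η, norm_smul, hu]
  have hzero : ∑ i, (rankOne ℂ (φ i) (η i) + rankOne ℂ (η i) (φ i)) = 0 := by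
    have h1 : ∀ i, rankOne ℂ (φ i) (η i) + rankOne ℂ (η i) (φ i) =
        rankOne ℂ (z i • φ i) u + rankOne ℂ u (z i • φ i) := by
      intro i
      simp [η, map_smulₛₗ]
    simp only [h1]
    rw [Finset.sum_add_distrib, ← map_sum (rankOne ℂ u), hsum,
      ← sum_apply, ← map_sum, hsum]
    simp
  obtain ⟨e, l, g, he, hl, hg, hle⟩ := hmin.exists_second_order hf_nonneg hf_mono
    hf_strict.convexOn hφ hφ0 hη hzero
  refine absurd hle (not_le.2 ?_)
  have hstep : ∀ k, z k ≠ 0 → ∑ j, g j * ‖inner ℂ (e j) (η k)‖ ^ 2 <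
      ‖η k‖ ^ 2 / ‖φ k‖ ^ 2 * ∑ j, g j * ‖inner ℂ (e j) (φ k)‖ ^ 2 := by
    intro k hk
    have hbc := hz k hk
    have hmid : 0 ≤ (b + c k) / 2 := by linarith
    -- A subgradient at the midpoint separates those at `b` from those at `c k`.
    obtain ⟨γ, -, -, hγ⟩ := hf_strict.convexOn.exists_isSubgradientAt hf_mono hmid
    have hlow : ∑ j, g j * ‖inner ℂ (e j) (η k)‖ ^ 2 ≤ γ * ‖η k‖ ^ 2 := by
      rw [← e.sum_sq_norm_inner_right, Finset.mul_sum]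
      refine Finset.sum_le_sum fun j _ => ?_
      by_cases hj : l j = b
      · refine mul_le_mul_of_nonneg_right ?_ (by positivity)
        exact (hg j).le_of_lt (hl j) (by linarith) hγ
      · have : inner ℂ (e j) (η k) = 0 := by
          simp only [η, inner_smul_right]
          rw [inner_eq_zero_of_eigenvalue_ne (he j) hbu hj, mul_zero]
        simp [this]
    have hterm : ∀ j, γ * ‖inner ℂ (e j) (φ k)‖ ^ 2 ≤ g j * ‖inner ℂ (e j) (φ k)‖ ^ 2 ∧
        (inner ℂ (e j) (φ k) ≠ 0 →
          γ * ‖inner ℂ (e j) (φ k)‖ ^ 2 < g j * ‖inner ℂ (e j) (φ k)‖ ^ 2) := by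
      intro j
      by_cases hj : l j = c k
      · have h1 : γ < g j := hγ.lt_of_lt hf_strict hmid (by linarith) (hg j)
        refine ⟨mul_le_mul_of_nonneg_right h1.le (by positivity), fun h => ?_⟩
        exact mul_lt_mul_of_pos_right h1 (by positivity)
      · have h1 : inner ℂ (e j) (φ k) = 0 := inner_eq_zero_of_eigenvalue_ne (he j) (hc k) hj
        simp [h1]
    have hhigh : γ * ‖φ k‖ ^ 2 < ∑ j, g j * ‖inner ℂ (e j) (φ k)‖ ^ 2 := by
      rw [← e.sum_sq_norm_inner_right, Finset.mul_sum]
      obtain ⟨j, hj⟩ : ∃ j, inner ℂ (e j) (φ k) ≠ 0 := by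
        by_contra! h
        apply hφ0 k
        rw [← e.sum_repr' (φ k)]
        simp [h]
      exact Finset.sum_lt_sum (fun j _ => (hterm j).1) ⟨j, Finset.mem_univ j, (hterm j).2 hj⟩
    have hφk : 0 < ‖φ k‖ ^ 2 := pow_pos (norm_pos_iff.2 (hφ0 k)) 2
    have hηk : 0 < ‖η k‖ ^ 2 := by
      rw [hnη]
      exact pow_pos (norm_pos_iff.2 hk) 2
    calc _ ≤ γ * ‖η k‖ ^ 2 := hlow
      _ = ‖η k‖ ^ 2 / ‖φ k‖ ^ 2 * (γ * ‖φ k‖ ^ 2) := by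
        rw [mul_left_comm, div_mul_cancel₀ _ hφk.ne']
      _ < _ := mul_lt_mul_of_pos_left hhigh (div_pos hηk hφk)
  refine Finset.sum_lt_sum (fun k _ => ?_) ⟨i, Finset.mem_univ i, hstep i hi⟩
  by_cases hk : z k = 0
  · simp [η, hk]
  · exact (hstep k hk).le

end LocalMin

/-! ### From eigenvectors to the form `(∗)`. -/

section Structure

variable {m d : ℕ} {a : Fin m → ℝ}

theorem Antitone.exists_lt_iff_val_lt (ha : Antitone a) (b : ℝ) :
    ∃ r ≤ m, ∀ i : Fin m, b < a i ↔ (i : ℕ) < r := by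
  classical
  have hex : ∃ n : ℕ, ∀ i : Fin m, n ≤ (i : ℕ) → a i ≤ b :=
    ⟨m, fun i hi => absurd i.2 (not_lt.2 hi)⟩
  refine ⟨Nat.find hex, Nat.find_min' hex fun i hi => absurd i.2 (not_lt.2 hi), fun i => ?_⟩
  constructor
  · intro h
    by_contra hi
    exact absurd h (not_lt.2 (Nat.find_spec hex i (not_lt.1 hi)))
  · intro h
    have h1 := Nat.find_min hex h
    push Not at h1
    obtain ⟨k, hk, hb⟩ := h1
    exact hb.trans_le (ha (Fin.le_def.2 hk))

/-- At `r` the inequality holds since `a_r > b`. Beyond `r` every entry is at most `b`, so deleting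
some leaves a tail of at least the remaining multiple of `b`, and the inequality fails. -/
theorem irregularity_eq_of_sum_tail_eq (hdm : d ≤ m) {r : ℕ} (hr : r < d) {b : ℝ}
    (hb : ∀ i : Fin m, b < a i ↔ (i : ℕ) < r)
    (hsum : ∑ i : {i : Fin m // r ≤ (i : ℕ)}, a i = ((d : ℝ) - r) * b) :
    irregularity d a = r := by
  refine irregularity_eq (by omega) (fun i hi => ?_) (by omega) (fun i hi hid => ?_)
  · rw [hsum]
    exact mul_lt_mul_of_pos_left ((hb i).2 (by omega)) (sub_pos.2 (by exact_mod_cast hr))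
  · have hai : ∀ k : Fin m, r ≤ (k : ℕ) → a k ≤ b := fun k hk =>
      not_lt.1 fun h => absurd ((hb k).1 h) (not_lt.2 hk)
    have him : (i : ℕ) + 1 ≤ m := i.2
    have h1 := Fin.sum_castLE_add_sum_subtype (hr.le.trans hdm) a
    have h2 := Fin.sum_castLE_add_sum_subtype him a
    have h3 := Fin.sum_castLE_add_sum_subtype (show r ≤ (i : ℕ) + 1 by omega)
      fun k => a (Fin.castLE him k)
    have h4 : ∑ k : {k : Fin ((i : ℕ) + 1) // r ≤ (k : ℕ)}, a (Fin.castLE him k) ≤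
        (((i : ℕ) : ℝ) + 1 - r) * b := by
      have h5 := Finset.sum_le_card_nsmul Finset.univ
        (fun k : {k : Fin ((i : ℕ) + 1) // r ≤ (k : ℕ)} => a (Fin.castLE him k)) b
        fun k _ => hai _ k.2
      rw [nsmul_eq_mul, Finset.card_univ, Fin.card_subtype_le_val (by omega)] at h5
      push_cast at h5
      exact h5
    have h6 : ∑ k : Fin r, a (Fin.castLE him (Fin.castLE (show r ≤ (i : ℕ) + 1 by omega) k)) =
        ∑ k : Fin r, a (Fin.castLE (hr.le.trans hdm) k) := rfl
    have h7 : ((d : ℝ) - ((i : ℕ) + 1)) * a i ≤ ((d : ℝ) - ((i : ℕ) + 1)) * b :=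
      mul_le_mul_of_nonneg_left (hai i hi)
        (sub_nonneg.2 (by exact_mod_cast (show (i : ℕ) + 1 ≤ d by omega)))
    rw [h6] at h3
    linarith

/-- A sequence all of whose members are eigenvectors of its frame operator, those for
non-minimal eigenvalues being linearly independent, has the form of a minimizer. -/
theorem hasMinimizerForm_of_eigenvectors (hd : 0 < d) (hdm : d ≤ m) (ha_pos : ∀ i, 0 < a i)
    (ha : Antitone a) {φ : Fin m → EuclideanSpace ℂ (Fin d)} (hφ : φ ∈ normSeqs d a)
    {c : Fin m → ℝ} (hc : ∀ i, frameOp φ (φ i) = (c i : ℂ) • φ i)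
    (hind : ∀ (u : EuclideanSpace ℂ (Fin d)) (b : ℝ), ‖u‖ = 1 → 0 ≤ b →
      frameOp φ u = (b : ℂ) • u → ∀ z : Fin m → ℂ, (∀ i, z i ≠ 0 → b < c i) →
      ∑ i, z i • φ i = 0 → ∀ i, z i = 0) :
    HasMinimizerForm a φ := by
  classical
  have hφ' : ∀ i, ‖φ i‖ ^ 2 = a i := hφ
  have hφ0 : ∀ i, φ i ≠ 0 := fun i h => by
    have := hφ' i
    rw [h, norm_zero, zero_pow two_ne_zero] at this
    exact (ha_pos i).ne this
  have hself : ∀ i, inner ℂ (φ i) (φ i) = (a i : ℂ) := fun i => by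
    rw [inner_self_eq_norm_sq_to_K, ← hφ' i]
    simp
  obtain ⟨u, l, hu, hl⟩ := exists_eigenbasis_frameOp φ
  have : Nonempty (Fin d) := ⟨⟨0, hd⟩⟩
  obtain ⟨j₀, hj₀⟩ := Finite.exists_min l
  set b := l j₀
  have hbc : ∀ i, b ≤ c i := by
    intro i
    obtain ⟨j, hj⟩ : ∃ j, inner ℂ (u j) (φ i) ≠ 0 := by
      by_contra! h
      apply hφ0 i
      rw [← u.sum_repr' (φ i)]
      simp [h]
    have : l j = c i := by
      by_contra h
      exact hj (inner_eq_zero_of_eigenvalue_ne (hu j) (hc i) h)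
    exact this ▸ hj₀ j
  -- The relation is `∑ ⟨φ_k, φ_i⟩ φ_k - c_i φ_i = 0`. It involves only vectors with eigenvalue
  -- `c_i`, so all its coefficients vanish.
  have hhigh : ∀ i, b < c i → a i = c i ∧ ∀ k, k ≠ i → inner ℂ (φ k) (φ i) = 0 := by
    intro i hi
    have hz := hind (u j₀) b (u.norm_eq_one j₀) (hl j₀) (hu j₀)
      (fun k => inner ℂ (φ k) (φ i) - if k = i then (c i : ℂ) else 0) ?_ ?_
    · refine ⟨?_, fun k hk => by simpa [hk] using hz k⟩
      have h1 := hz i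
      simp only [if_true, hself] at h1
      exact_mod_cast sub_eq_zero.1 h1
    · intro k hk
      by_cases hki : k = i
      · rwa [hki]
      · simp only [hki, if_false, sub_zero] at hk
        have : c k = c i := by
          by_contra h
          exact hk (inner_eq_zero_of_eigenvalue_ne (hc k) (hc i) h)
        rwa [this]
    · simp only [sub_smul, Finset.sum_sub_distrib, ← frameOp_apply, hc, ite_smul, zero_smul,
        Finset.sum_ite_eq', Finset.mem_univ, if_true, sub_self]
  have hac : ∀ i, a i ≤ c i := by
    intro i
    have h1 : c i * a i = ∑ k, ‖inner ℂ (φ i) (φ k)‖ ^ 2 := by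
      have h2 := inner_frameOp φ (φ i)
      rw [hc, inner_smul_right, hself] at h2
      exact_mod_cast h2
    have h2 : ‖inner ℂ (φ i) (φ i)‖ ^ 2 ≤ ∑ k, ‖inner ℂ (φ i) (φ k)‖ ^ 2 :=
      Finset.single_le_sum (f := fun k => ‖inner ℂ (φ i) (φ k)‖ ^ 2) (fun k _ => by positivity)
        (Finset.mem_univ i)
    rw [hself, Complex.norm_real, Real.norm_of_nonneg (ha_pos i).le, ← h1, sq] at h2
    exact le_of_mul_le_mul_right h2 (ha_pos i)
  -- By `hhigh` and `hac`, `b < a i` and `b < c i` are equivalent, so the non-minimal eigenvalues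
  -- occupy an initial segment of indices.
  obtain ⟨r, hrm, hr⟩ := ha.exists_lt_iff_val_lt b
  have hlow : ∀ i : Fin m, r ≤ (i : ℕ) → c i = b := by
    intro i hi
    by_contra h
    have h1 : b < c i := lt_of_le_of_ne (hbc i) (Ne.symm h)
    rw [← (hhigh i h1).1] at h1
    exact absurd ((hr i).1 h1) (not_lt.2 hi)
  have hup : ∀ i : Fin m, (i : ℕ) < r → b < c i := fun i hi => ((hr i).2 hi).trans_le (hac i)
  set v : Fin d → EuclideanSpace ℂ (Fin d) := fun j =>
    ((Real.sqrt (a (Fin.castLE hdm j)) : ℝ) : ℂ)⁻¹ • φ (Fin.castLE hdm j)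
  have hsq : ∀ i, ((Real.sqrt (a i) : ℝ) : ℂ) ≠ 0 := fun i => by
    exact_mod_cast (Real.sqrt_pos.2 (ha_pos i)).ne'
  have hv : Orthonormal ℂ (({j : Fin d | (j : ℕ) < r}).domRestrict v) := by
    constructor
    · rintro ⟨j, hj⟩
      have h1 : ‖φ (Fin.castLE hdm j)‖ = Real.sqrt (a (Fin.castLE hdm j)) := by
        rw [← hφ', Real.sqrt_sq (norm_nonneg _)]
      change ‖v j‖ = 1
      rw [norm_smul, h1, norm_inv, Complex.norm_real, Real.norm_of_nonneg (Real.sqrt_nonneg _),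
        inv_mul_cancel₀ (Real.sqrt_pos.2 (ha_pos _)).ne']
    · rintro ⟨j, hj⟩ ⟨k, hk⟩ hjk
      change inner ℂ (v j) (v k) = 0
      have hne : Fin.castLE hdm j ≠ Fin.castLE hdm k := fun h => hjk (by
        simpa using h)
      rw [inner_smul_left, inner_smul_right, (hhigh _ (hup (Fin.castLE hdm k) hk)).2 _ hne]
      simp
  obtain ⟨e, he⟩ := hv.exists_orthonormalBasis_extension_of_card_eq (by simp)
  have heφ : ∀ (i : Fin m) (j : Fin d), (i : ℕ) = (j : ℕ) → (i : ℕ) < r →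
      φ i = ((Real.sqrt (a i) : ℝ) : ℂ) • e j := by
    intro i j hij hi
    have h1 : Fin.castLE hdm j = i := Fin.ext hij.symm
    rw [he j (show (j : ℕ) < r from hij ▸ hi)]
    simp only [v, h1]
    rw [smul_inv_smul₀ (hsq i)]
  have heS : ∀ (j : Fin d) (hj : (j : ℕ) < r),
      frameOp φ (e j) = (a (Fin.castLE hdm j) : ℂ) • e j := by
    intro j hj
    have h1 : b < c (Fin.castLE hdm j) := hup _ hj
    rw [he j hj, map_smul, hc, ← (hhigh _ h1).1, smul_comm]
  -- Otherwise the `b`-eigenvector `u j₀` would be orthogonal to a whole basis of eigenvectors with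
  -- larger eigenvalues.
  have hrd : r < d := by
    by_contra h
    have h1 : ∀ j, inner ℂ (e j) (u j₀) = 0 := by
      intro j
      have hj : (j : ℕ) < r := j.2.trans_le (not_lt.1 h)
      refine inner_eq_zero_of_eigenvalue_ne (heS j hj) (hu j₀) ?_
      exact ((hr (Fin.castLE hdm j)).2 hj).ne'
    have h2 := u.norm_eq_one j₀
    rw [← e.sum_repr' (u j₀)] at h2
    simp [h1] at h2
  have hb : 0 < b := by
    refine (ha_pos ⟨r, hrd.trans_le hdm⟩).trans_le (not_lt.1 fun h => ?_)
    exact lt_irrefl _ ((hr _).1 h)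
  have hVφ : ∀ x, (∀ j : Fin d, (j : ℕ) < r → inner ℂ (e j) x = 0) → ∀ i : Fin m, (i : ℕ) < r →
      inner ℂ (φ i) x = 0 := by
    intro x hx i hi
    by_cases hid : (i : ℕ) < d
    · rw [heφ i ⟨i, hid⟩ rfl hi, inner_smul_left, hx _ hi, mul_zero]
    · omega
  have hVS : ∀ x, (∀ j : Fin d, (j : ℕ) < r → inner ℂ (e j) x = 0) →
      frameOp φ x = (b : ℂ) • x := by
    intro x hx
    refine frameOp_apply_eq_smul_of_inner_eq_zero hu fun k hk => ?_
    have hlk : (l k : ℂ) ≠ 0 := by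
      exact_mod_cast (hb.trans_le (hj₀ k)).ne'
    -- For `l k ≠ b` the vectors `φ i` with `i ≥ r` are orthogonal to `u k`, so `S u_k` lies in the
    -- span of the first `r` vectors, hence is orthogonal to `x`.
    have h1 : inner ℂ (frameOp φ (u k)) x = 0 := by
      rw [frameOp_apply, sum_inner]
      refine Finset.sum_eq_zero fun i _ => ?_
      rw [inner_smul_left]
      by_cases hi : (i : ℕ) < r
      · rw [hVφ x hx i hi, mul_zero]
      · rw [inner_eq_zero_of_eigenvalue_ne (hc i) (hu k)
          (by rw [hlow i (not_lt.1 hi)]; exact Ne.symm hk), map_zero, zero_mul]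
    rw [hu, inner_smul_left, Complex.conj_ofReal] at h1
    exact (mul_eq_zero.1 h1).resolve_left hlk
  -- The trace computed in the basis `e`: the head contributes `a_1, …, a_r`, the tail `b` for each
  -- of its `d - r` vectors.
  have htrace : ∑ i : {i : Fin m // r ≤ (i : ℕ)}, a i = ((d : ℝ) - r) * b := by
    have h1 := sum_inner_frameOp φ e
    simp only [hφ'] at h1
    rw [← Fin.sum_castLE_add_sum_subtype hrd.le, ← Fin.sum_castLE_add_sum_subtype hrm] at h1
    have h2 : ∀ (j : Fin d) (t : ℝ), frameOp φ (e j) = (t : ℂ) • e j →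
        (inner ℂ (e j) (frameOp φ (e j))).re = t := by
      intro j t h
      rw [h, inner_smul_right, inner_self_eq_norm_sq_to_K, e.norm_eq_one]
      simp
    have h3 : ∑ k : Fin r, (inner ℂ (e (Fin.castLE hrd.le k))
        (frameOp φ (e (Fin.castLE hrd.le k)))).re = ∑ k : Fin r, a (Fin.castLE hrm k) :=
      Finset.sum_congr rfl fun k _ => h2 _ _ (heS _ k.2)
    have h4 : ∑ j : {j : Fin d // r ≤ (j : ℕ)}, (inner ℂ (e j) (frameOp φ (e j))).re =
        ((d : ℝ) - r) * b := by
      rw [Finset.sum_congr rfl fun (j : {j : Fin d // r ≤ (j : ℕ)}) _ => h2 _ b (hVS _ ?_)]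
      · rw [Finset.sum_const, nsmul_eq_mul, Finset.card_univ, Fin.card_subtype_le_val hrd.le]
      · intro k hk
        refine e.inner_eq_zero fun h => ?_
        rw [h] at hk
        exact absurd hk (not_lt.2 j.2)
    linarith
  have hirr := irregularity_eq_of_sum_tail_eq hdm hrd hr htrace
  subst hirr
  have hpos : (0 : ℝ) < d - irregularity d a := sub_pos.2 (by exact_mod_cast hrd)
  refine ⟨e, heφ, ?_⟩
  rw [htrace, inv_mul_cancel_left₀ hpos.ne']
  refine ⟨hb, hb, fun i => e.mem_span_tail_iff.2 fun j hj => ?_, fun x hx => ?_⟩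
  · have h1 : b < a (Fin.castLE hdm j) := (hr (Fin.castLE hdm j)).2 hj
    refine inner_eq_zero_of_eigenvalue_ne (heS j hj) (hc i) ?_
    rw [hlow i i.2]
    exact h1.ne'
  · have hx' := e.mem_span_tail_iff.1 hx
    have h1 := inner_frameOp φ x
    rw [hVS x hx', inner_smul_right, inner_self_eq_norm_sq_to_K] at h1
    have h2 : b * ‖x‖ ^ 2 = ∑ i, ‖inner ℂ x (φ i)‖ ^ 2 := by
      apply Complex.ofReal_injective
      rw [← h1, Complex.ofReal_mul, Complex.ofReal_pow]
      rfl
    have h3 : ∑ k : Fin (irregularity d a), ‖inner ℂ x (φ (Fin.castLE hrm k))‖ ^ 2 = 0 := by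
      refine Finset.sum_eq_zero fun k _ => ?_
      rw [norm_inner_symm, hVφ x hx' _ k.2, norm_zero, zero_pow two_ne_zero]
    rw [← Fin.sum_castLE_add_sum_subtype hrm, h3, zero_add] at h2
    exact ⟨h2.le, h2.ge⟩

end Structure

theorem mainTheorem1 (f : ℝ → ℝ) (hf_nonneg : ∀ x ∈ Set.Ici (0 : ℝ), 0 ≤ f x)
    (hf_mono : MonotoneOn f (Set.Ici 0)) (hf_conv : ConvexOn ℝ (Set.Ici 0) f)
    (m d : ℕ) (hd : 0 < d) (hdm : d ≤ m)
    (a : Fin m → ℝ) (ha_pos : ∀ i, 0 < a i) (ha_anti : Antitone a) :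
    (∀ φ ∈ normSeqs d a, HasMinimizerForm a φ →
      frameOp φ ∈ frameOps d a ∧ IsMinOn (framePotential f) (frameOps d a) (frameOp φ)) ∧
    (StrictConvexOn ℝ (Set.Ici 0) f →
      ∀ φ ∈ normSeqs d a, IsLocalMinOn (framePotential f) (frameOps d a) (frameOp φ) →
        HasMinimizerForm a φ) := by
  refine ⟨fun φ hφ h => ⟨⟨φ, hφ, rfl⟩, h.isMinOn hf_mono hf_conv hd hdm ha_pos ha_anti⟩,
    fun hf_strict φ hφ hmin => ?_⟩
  have hφ0 : ∀ i, φ i ≠ 0 := fun i h => by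
    have h1 : ‖φ i‖ ^ 2 = a i := hφ i
    rw [h, norm_zero, zero_pow two_ne_zero] at h1
    exact (ha_pos i).ne h1
  choose c _ hc using hmin.exists_eigenvalue hf_nonneg hf_mono hf_strict hφ hφ0
  exact hasMinimizerForm_of_eigenvectors hd hdm ha_pos ha_anti hφ hc
    fun u b hu hb hbu z hz hsum => hmin.coeff_eq_zero hf_nonneg hf_mono hf_strict hφ hφ0 hc hu
      hb hbu hz hsum
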